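/- **Theorem.** Let $M$ be a compact manifold without boundary, let $k\ge 1$, let $x\in C^\infty(M)$ have $0$ as a regular value, and put $Z=x^{-1}(0)$. For $m\ge 1$ the $b^m$-tangent bundle of $(M,Z,x)$ is the vector bundle ${}^{b^m}TM=\{(v,s)\in TM\oplus\mathbb R : dx(v)=x^m s\}$; its sections are the vector fields $v$ such that $dx(v)$ is $x^m$ times a smooth function, its fibre is $T_pM$ at $p\notin Z$ and $T_pZ\oplus\langle x^m\frac{\partial}{\partial x}\rangle$ at $p\in Z$, and $\frac{dx}{x^m}$ denotes the section $(v,s)\mapsto s$ of its dual. A $b^m$-symplectic form is a smooth section $\omega$ of $\Lambda^2({}^{b^m}T^*M)$ (locally $\frac{dx}{x^m}\wedge\alpha+\beta$ with smooth forms $\alpha$, $\beta$) which is closed and is nondegenerate on ${}^{b^m}T_pM$ for every $p\in M$. Let $\omega$ be a $b^{2k}$-symplectic form on $(M,Z,x)$. Then $M$ admits a symplectic form, namely a desingularization $\omega_\epsilon$ of $\omega$. In detail: 1. There is a function $f\in C^\infty(\mathbb R)$ which is odd, satisfies $f'>0$ on $[-1,1]$, and equals $\frac{-1}{(2k-1)t^{2k-1}}-2$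 for $t<-1$ and $\frac{-1}{(2k-1)t^{2k-1}}+2$ for $t>1$. 2. $\omega$ has a Laurent decomposition: there are a tubular neighbourhood $U$ of $Z$ with projection $\pi:U\to Z$, such that $(\pi,x):U\to Z\times(-\delta,\delta)$ is a diffeomorphism for some $\delta>0$, closed one-forms $\hat\alpha_0,\dots,\hat\alpha_{2k-1}$ on $Z$, and a smooth two-form $\beta$ on $U$, with $$\omega=\frac{dx}{x^{2k}}\wedge\sum_{i=0}^{2k-1}x^i\,\pi^*\hat\alpha_i+\beta\quad\text{on }U .$$ 3. For every $f$ as in 1 and every Laurent decomposition as in 2 there is $\epsilon_0>0$ such that for all $0<\epsilon<\epsilon_0$ the two-form $\omega_\epsilon$ on $M$, given with $f_\epsilon(t)=\epsilon^{-(2k-1)}f(t/\epsilon)$ by $$\omega_\epsilon=d(f_\epsilon\circ x)\wedge\sum_{i=0}^{2k-1}x^i\,\pi^*\hat\alpha_i+\beta\ \text{ on }U,\qquad \omega_\epsilon=\omega\ \text{ on }M\setminus U,$$ is a (smooth) symplectic form on $M$, and $\omega_\epsilon=\omega$ on $\{|x|\ge\epsilon\}$. 4. Hence all obstructions to being symplectic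 apply to $b^{2k}$-symplectic manifolds: $M$ has every property that all compact symplectic manifolds (of the dimension of $M$) have. -/

import Mathlib

open scoped Manifold ContDiff

universe u v

noncomputable section

namespace BSymplectic

section Forms

variable {E : Type v} [NormedAddCommGroup E] [NormedSpace ℝ E]
  {M : Type u} [TopologicalSpace M] [ChartedSpace E M]

/-- A (not necessarily smooth) field of alternating `j`-forms on the tangent spaces of `M`. The
tangent space `TangentSpace 𝓘(ℝ, E) p` is by definition a copy of `E` (through the preferred chart
at `p`), and is written as `E` here and below. -/
abbrev Form (E : Type v) [NormedAddCommGroup E] [NormedSpace ℝ E]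
    (M : Type u) [TopologicalSpace M] [ChartedSpace E M] (j : ℕ) : Type (max u v) :=
  M → E [⋀^Fin j]→L[ℝ] ℝ

/-- The differential `T_p M → T_{φ(p)} N` of a map of manifolds modelled on `E` and `E'`. -/
def D (E : Type*) [NormedAddCommGroup E] [NormedSpace ℝ E]
    (E' : Type*) [NormedAddCommGroup E'] [NormedSpace ℝ E']
    {M : Type*} [TopologicalSpace M] [ChartedSpace E M]
    {N : Type*} [TopologicalSpace N] [ChartedSpace E' N] (φ : M → N) (p : M) : E →L[ℝ] E' :=
  mfderiv 𝓘(ℝ, E) 𝓘(ℝ, E') φ p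

/-- The expression of a form in a chart `e`: its pullback under `e.symm`. -/
def Form.inChart {j : ℕ} (η : Form E M j) (e : OpenPartialHomeomorph M E) :
    E → E [⋀^Fin j]→L[ℝ] ℝ :=
  fun y => (η (e.symm y)).compContinuousLinearMap (D E E e.symm y)

/-- A form is smooth on the open set `U` if all its chart expressions are. -/
def Form.SmoothOn {j : ℕ} (η : Form E M j) (U : Set M) : Prop :=
  ∀ e ∈ atlas E M, ContDiffOn ℝ ∞ (η.inChart e) (e.target ∩ e.symm ⁻¹' U)

/-- A form that is smooth on the open set `U` is closed on `U` if the exterior derivatives of its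
chart expressions vanish. -/
def Form.ClosedOn {j : ℕ} (η : Form E M j) (U : Set M) : Prop :=
  ∀ e ∈ atlas E M, ∀ y ∈ e.target ∩ e.symm ⁻¹' U, extDeriv (η.inChart e) y = 0

/-- A symplectic form: a smooth closed nondegenerate `2`-form. -/
structure IsSymplectic (σ : Form E M 2) : Prop where
  smooth : σ.SmoothOn Set.univ
  closed : σ.ClosedOn Set.univ
  nondegenerate : ∀ (p : M) (v : E), (∀ w : E, σ p ![v, w] = 0) → v = 0

end Forms

/-- The wedge product `a ∧ b` of a covector `a` with a `j`-covector `b`,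
`(a ∧ b)(v₀, …, v_j) = ∑ i, (-1)^i a(v_i) b(v₀, …, v̂_i, …, v_j)`. -/
def wedge {V : Type*} [NormedAddCommGroup V] [NormedSpace ℝ V] {j : ℕ}
    (a : V →L[ℝ] ℝ) (b : V [⋀^Fin j]→L[ℝ] ℝ) : V [⋀^Fin (j + 1)]→L[ℝ] ℝ :=
  ContinuousAlternatingMap.alternatizeUncurryFin (a.smulRight b)

section BForms

variable {E : Type v} [NormedAddCommGroup E] [NormedSpace ℝ E]
  {M : Type u} [TopologicalSpace M] [ChartedSpace E M]

/-- `x` is smooth and `0` is a regular value of `x`, so that `(M, Z, x)` with `Z = x⁻¹(0)` is a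
`b^m`-manifold. -/
structure IsDefiningFunction (E : Type v) [NormedAddCommGroup E] [NormedSpace ℝ E]
    {M : Type u} [TopologicalSpace M] [ChartedSpace E M] (x : M → ℝ) : Prop where
  smooth : ContMDiff 𝓘(ℝ, E) 𝓘(ℝ, ℝ) ∞ x
  regular : ∀ p : M, x p = 0 → D E ℝ x p ≠ 0

/-- The fibre at `p` of the `b^m`-tangent bundle of `(M, Z, x)`, realised as the subbundle
`{(v, s) : dx(v) = x^m s}` of `TM ⊕ ℝ`. Its sections are the vector fields `v` for which `dx(v)`
is `x^m` times a smooth function `s`. Off `Z` the first projection identifies the fibre with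
`T_p M`; at a point of `Z` (when `0 < m`) the fibre is `T_p Z ⊕ ℝ`, where `(0, 1)` is
the value of the section `x^m ∂/∂x`. The covector `(v, s) ↦ s` is `dx / x^m`. -/
def bTangent (E : Type v) [NormedAddCommGroup E] [NormedSpace ℝ E]
    {M : Type u} [TopologicalSpace M] [ChartedSpace E M] (x : M → ℝ) (m : ℕ) (p : M) :
    Submodule ℝ (E × ℝ) where
  carrier := {u | D E ℝ x p u.1 = x p ^ m * u.2}
  add_mem' := by
    intro a b ha hb
    simp only [Set.mem_ofPred_eq, Prod.fst_add, Prod.snd_add, map_add] at *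
    rw [ha, hb]; ring
  zero_mem' := by simp
  smul_mem' := by
    intro c a ha
    simp only [Set.mem_ofPred_eq, Prod.smul_fst, Prod.smul_snd, map_smul, smul_eq_mul] at *
    rw [ha]; ring

/-- A (not necessarily smooth) field of alternating `2`-forms on the `b^m`-tangent spaces. -/
abbrev BForm (E : Type v) [NormedAddCommGroup E] [NormedSpace ℝ E]
    {M : Type u} [TopologicalSpace M] [ChartedSpace E M] (x : M → ℝ) (m : ℕ) : Type (max u v) :=
  ∀ p : M, bTangent E x m p [⋀^Fin 2]→L[ℝ] ℝ

/-- The `b^m`-form `(dx / x^m) ∧ α + β`. -/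
def bFormOf (x : M → ℝ) (m : ℕ) (α : Form E M 1) (β : Form E M 2) : BForm E x m :=
  fun p =>
    (wedge (ContinuousLinearMap.snd ℝ E ℝ)
        ((α p).compContinuousLinearMap (ContinuousLinearMap.fst ℝ E ℝ)) +
      (β p).compContinuousLinearMap (ContinuousLinearMap.fst ℝ E ℝ)).compContinuousLinearMap
      (bTangent E x m p).subtypeL

/-- A `b^m`-form is a smooth section of `Λ²(ᵇᵐT*M)` if locally it is `(dx / x^m) ∧ α + β` with
smooth forms `α` and `β`. -/
def BForm.Smooth {x : M → ℝ} {m : ℕ} (Ω : BForm E x m) : Prop :=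
  ∀ q : M, ∃ V : Set M, IsOpen V ∧ q ∈ V ∧ ∃ (α : Form E M 1) (β : Form E M 2),
    α.SmoothOn V ∧ β.SmoothOn V ∧ ∀ p ∈ V, Ω p = bFormOf x m α β p

/-- Off `Z`, the inverse `v ↦ (v, dx(v) / x^m)` of the identification of the `b^m`-tangent space
with the tangent space. -/
def bLift (x : M → ℝ) (m : ℕ) (p : M) (hp : x p ≠ 0) : E →L[ℝ] bTangent E x m p :=
  ((ContinuousLinearMap.id ℝ E).prod ((x p ^ m)⁻¹ • D E ℝ x p)).codRestrict
    (bTangent E x m p) (fun v => by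
      change D E ℝ x p v = x p ^ m * ((x p ^ m)⁻¹ * D E ℝ x p v)
      rw [mul_inv_cancel_left₀ (pow_ne_zero m hp)])

open Classical in
/-- The ordinary `2`-form on `M ∖ Z` given by a `b^m`-form (with value `0` on `Z`). -/
def BForm.toForm {x : M → ℝ} {m : ℕ} (Ω : BForm E x m) : Form E M 2 :=
  fun p => if hp : x p ≠ 0 then (Ω p).compContinuousLinearMap (bLift x m p hp) else 0

/-- A symplectic `b^m`-form: a smooth closed `b^m`-form of degree `2` which has maximal rank at
every point. As `M ∖ Z` is dense, the differential of a smooth `b^m`-form vanishes if and only if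
it vanishes off `Z`, where it is the de Rham differential. -/
structure IsBSymplectic {x : M → ℝ} {m : ℕ} (Ω : BForm E x m) : Prop where
  smooth : Ω.Smooth
  closed : Ω.toForm.ClosedOn {p | x p ≠ 0}
  nondegenerate : ∀ (p : M) (v : bTangent E x m p),
    (∀ w : bTangent E x m p, Ω p ![v, w] = 0) → v = 0

/-- The one-form `∑ i < m, x^i α_i`. -/
def laurentSum (x : M → ℝ) {m : ℕ} (α : Fin m → Form E M 1) : Form E M 1 :=
  fun p => ∑ i : Fin m, x p ^ (i : ℕ) • α i p

/-- A Laurent decomposition `Ω = (dx / x^m) ∧ ∑ i < m, x^i π^*(α̂_i) + β` of a `b^m`-form in a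
tubular neighbourhood `U ≅ Z × (-δ, δ)` of `Z = x⁻¹(0)` with projection `π : U → Z`, where the `α̂_i`
are closed one-forms on `Z`. The field `α i` is `π^*(α̂_i)`. That it is the pullback of a form
on `Z` is expressed by `α i = π^*(α i)`, with `α̂_i` the restriction of `α i` to `Z`; then
`α̂_i` is closed if and only if `α i` is. The values of `proj`, `α` and `β` off `U` are irrelevant. -/
structure LaurentDecomposition {x : M → ℝ} {m : ℕ} (Ω : BForm E x m) where
  /-- the tubular neighbourhood -/
  U : Set M
  isOpen_U : IsOpen U
  /-- its projection to `Z` -/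
  proj : M → M
  proj_smooth : ContMDiffOn 𝓘(ℝ, E) 𝓘(ℝ, E) ∞ proj U
  zero_subset : {p | x p = 0} ⊆ U
  proj_of_zero : ∀ p, x p = 0 → proj p = p
  /-- the width of the tubular neighbourhood -/
  δ : ℝ
  δ_pos : 0 < δ
  /-- `(π, x)` is a bijection from `U` to `Z × (-δ, δ)` … -/
  bijOn : Set.BijOn (fun p => (proj p, x p)) U ({z | x z = 0} ×ˢ Set.Ioo (-δ) δ)
  /-- … whose differential is injective, so that it is a diffeomorphism. -/
  immersive : ∀ p ∈ U, ∀ v : E, D E E proj p v = 0 → D E ℝ x p v = 0 → v = 0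
  α : Fin m → Form E M 1
  α_smooth : ∀ i, (α i).SmoothOn U
  α_closed : ∀ i, (α i).ClosedOn U
  α_pullback : ∀ i, ∀ p ∈ U,
    α i p = (α i (proj p)).compContinuousLinearMap (D E E proj p)
  β : Form E M 2
  β_smooth : β.SmoothOn U
  eq_on : ∀ p ∈ U, Ω p = bFormOf x m (laurentSum x α) β p

end BForms

/-- The functions `f` used for desingularizing `b^{2k}`-forms. -/
structure IsDesingularizing (k : ℕ) (f : ℝ → ℝ) : Prop where
  smooth : ContDiff ℝ ∞ f
  odd : ∀ t, f (-t) = -f t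
  deriv_pos : ∀ t ∈ Set.Icc (-1 : ℝ) 1, 0 < deriv f t
  eq_left : ∀ t < -1, f t = -1 / ((2 * (k : ℝ) - 1) * t ^ (2 * k - 1)) - 2
  eq_right : ∀ t > 1, f t = -1 / ((2 * (k : ℝ) - 1) * t ^ (2 * k - 1)) + 2

/-- `f_ε(t) = ε^{-(2k-1)} f(t / ε)`. -/
def scaled (k : ℕ) (f : ℝ → ℝ) (ε : ℝ) : ℝ → ℝ :=
  fun t => (ε ^ (2 * k - 1))⁻¹ * f (t / ε)

section Desingularization

variable {E : Type v} [NormedAddCommGroup E] [NormedSpace ℝ E]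
  {M : Type u} [TopologicalSpace M] [ChartedSpace E M]

open Classical in
/-- The `f_ε`-desingularization of a `b^{2k}`-form with a given Laurent decomposition on `U`: it is
`d(f_ε ∘ x) ∧ ∑ i < 2k, x^i α_i + β` on `U`, and `Ω` off `U`. -/
def LaurentDecomposition.desingularization {x : M → ℝ} {k : ℕ} {Ω : BForm E x (2 * k)}
    (L : LaurentDecomposition Ω) (f : ℝ → ℝ) (ε : ℝ) : Form E M 2 :=
  fun p =>
    if p ∈ L.U then wedge (D E ℝ (scaled k f ε ∘ x) p) (laurentSum x L.α p) + L.β p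
    else Ω.toForm p

end Desingularization

end BSymplectic

end

open BSymplectic

open scoped Topology

noncomputable section

set_option linter.unusedSectionVars false

namespace BSymplectic

/-! ### Wedge products and smooth families of alternating forms -/

section Algebra

variable {V : Type*} [NormedAddCommGroup V] [NormedSpace ℝ V]
  {W : Type*} [NormedAddCommGroup W] [NormedSpace ℝ W]

/-! The existence of a Laurent decomposition is a Taylor expansion transverse to `Z`. A partition of
unity gives a global expression `Ω = (dx / x^m) ∧ α + β₀`, because the pairs `(α, β₀)` representing
`Ω` at a point form an affine space. A tube around `Z` with projection `π` is constructed together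
with charts in which both `x` and `π` are linear (`IsDefiningFunction.exists_tube`). On `Z` the form
`α - π^*α` kills `TZ`, so Hadamard's lemma gives `dx ∧ α = dx ∧ (π^*α + x α')`. After `m` such
divisions the remainder `x^m α'` cancels the pole and is absorbed into `β` (`Tube.exists_expansion`,
`bAt_congr`).

The coefficients are closed because off `Z` the equation `dΩ = 0` reads `x^m dβ = dx ∧ ∑ x^i dα_i`.
Along a line transverse to `Z` in an adapted chart the `dα_i` are constant. After contraction with
the direction of the line, a polynomial in `t` of degree `< m` therefore equals `t^m` times a
continuous function, and its coefficients vanish (`closedAt_of_laurent`). It follows that `dβ = 0`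
off `Z`, and on `Z` by continuity.

For the desingularization, `f_ε' = t^{-2k}` where `|t| ≥ ε`, so `ω_ε = ω` there. Since `2k` is even,
this derivative is positive on both sides of `0`, which is what lets an odd `f` have positive
derivative throughout. Where `|x| < ε` the form is `c dx ∧ S + β` with `c ≥ κ ε^{-2k}`, hence `c⁻¹`
is uniformly small. Rescaling the transverse direction by `τ = c⁻¹` turns it into a family that
extends smoothly to `τ = 0`, and at points of `Z` the limit is `Ω` itself on `T_z Z ⊕ ℝ`.
Nondegeneracy is open, so it persists for small `τ` (`LaurentDecomposition.exists_nondegenerate`),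
and compactness of `M` makes `ε₀` uniform. -/

theorem wedge_apply {j : ℕ} (a : V →L[ℝ] ℝ) (b : V [⋀^Fin j]→L[ℝ] ℝ) (v : Fin (j + 1) → V) :
    wedge a b v = ∑ i : Fin (j + 1), (-1 : ℝ) ^ (i : ℕ) * (a (v i) * b (i.removeNth v)) := by
  simp only [wedge, ContinuousAlternatingMap.alternatizeUncurryFin_apply]
  refine Finset.sum_congr rfl fun i _ => ?_
  rw [zsmul_eq_mul]
  push_cast
  rfl

theorem wedge_one_apply (a : V →L[ℝ] ℝ) (b : V [⋀^Fin 1]→L[ℝ] ℝ) (v w : V) :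
    wedge a b ![v, w] = a v * b ![w] - a w * b ![v] := by
  rw [wedge_apply, Fin.sum_univ_two]
  have h0 : Fin.removeNth (0 : Fin 2) ![v, w] = ![w] := by
    ext i; fin_cases i; rfl
  have h1 : Fin.removeNth (1 : Fin 2) ![v, w] = ![v] := by
    ext i; fin_cases i; rfl
  rw [h0, h1]
  simp
  ring

theorem wedge_comp {j : ℕ} (a : V →L[ℝ] ℝ) (b : V [⋀^Fin j]→L[ℝ] ℝ) (L : W →L[ℝ] V) :
    (wedge a b).compContinuousLinearMap L = wedge (a.comp L) (b.compContinuousLinearMap L) := by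
  ext v
  simp only [ContinuousAlternatingMap.compContinuousLinearMap_apply, wedge_apply]
  rfl

/-- The wedge product as a continuous bilinear map. -/
def wedgeCLM (V : Type*) [NormedAddCommGroup V] [NormedSpace ℝ V] (j : ℕ) :
    (V →L[ℝ] ℝ) →L[ℝ] (V [⋀^Fin j]→L[ℝ] ℝ) →L[ℝ] (V [⋀^Fin (j + 1)]→L[ℝ] ℝ) :=
  (ContinuousLinearMap.compL ℝ _ _ _
    (ContinuousAlternatingMap.alternatizeUncurryFinCLM ℝ V ℝ)).comp
    (ContinuousLinearMap.smulRightL ℝ V (V [⋀^Fin j]→L[ℝ] ℝ))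

theorem wedgeCLM_apply {j : ℕ} (a : V →L[ℝ] ℝ) (b : V [⋀^Fin j]→L[ℝ] ℝ) :
    wedgeCLM V j a b = wedge a b := rfl

theorem wedge_add {j : ℕ} (a : V →L[ℝ] ℝ) (b b' : V [⋀^Fin j]→L[ℝ] ℝ) :
    wedge a (b + b') = wedge a b + wedge a b' := by
  simp only [← wedgeCLM_apply, map_add]

theorem wedge_sub {j : ℕ} (a : V →L[ℝ] ℝ) (b b' : V [⋀^Fin j]→L[ℝ] ℝ) :
    wedge a (b - b') = wedge a b - wedge a b' := by
  simp only [← wedgeCLM_apply, map_sub]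

theorem wedge_smul {j : ℕ} (c : ℝ) (a : V →L[ℝ] ℝ) (b : V [⋀^Fin j]→L[ℝ] ℝ) :
    wedge a (c • b) = c • wedge a b := by
  simp only [← wedgeCLM_apply, map_smul]

theorem smul_wedge {j : ℕ} (c : ℝ) (a : V →L[ℝ] ℝ) (b : V [⋀^Fin j]→L[ℝ] ℝ) :
    wedge (c • a) b = c • wedge a b := by
  simp only [← wedgeCLM_apply, map_smul, smul_apply]

theorem wedge_sum {j : ℕ} {ι : Type*} (s : Finset ι) (a : V →L[ℝ] ℝ)
    (b : ι → V [⋀^Fin j]→L[ℝ] ℝ) : wedge a (∑ i ∈ s, b i) = ∑ i ∈ s, wedge a (b i) := by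
  simp only [← wedgeCLM_apply, map_sum]

theorem add_comp {j : ℕ} (b b' : V [⋀^Fin j]→L[ℝ] ℝ) (L : W →L[ℝ] V) :
    (b + b').compContinuousLinearMap L =
      b.compContinuousLinearMap L + b'.compContinuousLinearMap L := rfl

theorem smul_comp {j : ℕ} (c : ℝ) (b : V [⋀^Fin j]→L[ℝ] ℝ) (L : W →L[ℝ] V) :
    (c • b).compContinuousLinearMap L = c • b.compContinuousLinearMap L := rfl

theorem comp_comp {X : Type*} [NormedAddCommGroup X] [NormedSpace ℝ X] {j : ℕ}
    (b : V [⋀^Fin j]→L[ℝ] ℝ) (L : W →L[ℝ] V) (L' : X →L[ℝ] W) :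
    (b.compContinuousLinearMap L).compContinuousLinearMap L' =
      b.compContinuousLinearMap (L.comp L') := rfl

theorem sum_comp {j : ℕ} {ι : Type*} (s : Finset ι) (b : ι → V [⋀^Fin j]→L[ℝ] ℝ)
    (L : W →L[ℝ] V) : (∑ i ∈ s, b i).compContinuousLinearMap L =
      ∑ i ∈ s, (b i).compContinuousLinearMap L := by
  ext v
  simp [ContinuousAlternatingMap.sum_apply]

/-- An alternating form is determined by its values on tuples of basis vectors. These values embed
the forms linearly into a finite power of `ℝ`, and a linear left inverse recovers the form from
them. -/
theorem contDiffAt_alternating_iff [FiniteDimensional ℝ V] {X : Type*} [NormedAddCommGroup X]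
    [NormedSpace ℝ X] {j : ℕ} {n : WithTop ℕ∞} {f : X → V [⋀^Fin j]→L[ℝ] ℝ} {y : X} :
    ContDiffAt ℝ n f y ↔ ∀ v, ContDiffAt ℝ n (fun z => f z v) y := by
  refine ⟨fun h v => (ContinuousAlternatingMap.apply ℝ V ℝ v).contDiff.contDiffAt.comp y h,
    fun h => ?_⟩
  let b := Module.finBasis ℝ V
  let L : (V [⋀^Fin j]→L[ℝ] ℝ) →ₗ[ℝ] ((Fin j → Fin (Module.finrank ℝ V)) → ℝ) :=
    { toFun := fun a s => a fun i => b (s i)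
      map_add' := fun _ _ => rfl
      map_smul' := fun _ _ => rfl }
  have hL : LinearMap.ker L = ⊥ := by
    rw [LinearMap.ker_eq_bot']
    intro a ha
    have : a.toAlternatingMap.toMultilinearMap = 0 :=
      Module.Basis.ext_multilinear (fun _ => b) fun s => congrFun ha s
    ext v
    exact congrArg (fun m : MultilinearMap ℝ (fun _ : Fin j => V) ℝ => m v) this
  obtain ⟨g, hg⟩ := L.exists_leftInverse_of_injective hL
  have hfg : f = fun z => LinearMap.toContinuousLinearMap g (L (f z)) := by
    funext z
    exact (LinearMap.congr_fun hg (f z)).symm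
  rw [hfg]
  refine (LinearMap.toContinuousLinearMap g).contDiff.contDiffAt.comp y ?_
  exact contDiffAt_pi.2 fun s => h _

/-- Evaluation is multilinear in the form and the vectors jointly, hence analytic. -/
theorem contDiffAt_apply_alternating [FiniteDimensional ℝ V] {X : Type*} [NormedAddCommGroup X]
    [NormedSpace ℝ X] {j : ℕ} {n : WithTop ℕ∞} {f : X → V [⋀^Fin j]→L[ℝ] ℝ} {v : X → Fin j → V}
    {y : X} (hf : ContDiffAt ℝ n f y) (hv : ContDiffAt ℝ n v y) :
    ContDiffAt ℝ n (fun z => f z (v z)) y := by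
  have h := (ContinuousAlternatingMap.toContinuousMultilinearMapCLM (E := V) (F := ℝ)
    (ι := Fin j) (𝕜 := ℝ) ℝ).analyticAt_uncurry_of_multilinear (x := (f y, v y))
  exact (h.contDiffAt (n := n)).comp y (hf.prodMk hv)

theorem contDiffAt_comp_alternating [FiniteDimensional ℝ V] [FiniteDimensional ℝ W]
    {X : Type*} [NormedAddCommGroup X]
    [NormedSpace ℝ X] {j : ℕ} {n : WithTop ℕ∞} {f : X → V [⋀^Fin j]→L[ℝ] ℝ} {L : X → W →L[ℝ] V}
    {y : X} (hf : ContDiffAt ℝ n f y) (hL : ContDiffAt ℝ n L y) :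
    ContDiffAt ℝ n (fun z => (f z).compContinuousLinearMap (L z)) y := by
  rw [contDiffAt_alternating_iff]
  intro v
  exact contDiffAt_apply_alternating (v := fun z i => L z (v i)) hf
    (contDiffAt_pi.2 fun i => hL.clm_apply contDiffAt_const)

end Algebra

/-! ### Chain rule for differentials -/

section Differential

variable {E : Type*} [NormedAddCommGroup E] [NormedSpace ℝ E]
  {E' : Type*} [NormedAddCommGroup E'] [NormedSpace ℝ E']
  {E'' : Type*} [NormedAddCommGroup E''] [NormedSpace ℝ E'']
  {M : Type*} [TopologicalSpace M] [ChartedSpace E M]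
  {N : Type*} [TopologicalSpace N] [ChartedSpace E' N]
  {P : Type*} [TopologicalSpace P] [ChartedSpace E'' P]

theorem D_comp {ψ : N → P} {φ : M → N} {p : M} (hψ : MDifferentiableAt 𝓘(ℝ, E') 𝓘(ℝ, E'') ψ (φ p))
    (hφ : MDifferentiableAt 𝓘(ℝ, E) 𝓘(ℝ, E') φ p) :
    D E E'' (ψ ∘ φ) p = (D E' E'' ψ (φ p)).comp (D E E' φ p) :=
  mfderiv_comp p hψ hφ

theorem D_eq_fderiv (f : E → E') (y : E) : D E E' f y = fderiv ℝ f y :=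
  mfderiv_eq_fderiv

theorem D_congr {φ ψ : M → N} {p : M} (h : φ =ᶠ[𝓝 p] ψ) : D E E' φ p = D E E' ψ p :=
  h.mfderiv_eq

theorem D_id (p : M) : D E E (id : M → M) p = ContinuousLinearMap.id ℝ E :=
  mfderiv_id

end Differential

/-! ### Forms and pullbacks in charts -/

section Charts

variable {E : Type v} [NormedAddCommGroup E] [NormedSpace ℝ E]
  {M : Type u} [TopologicalSpace M] [ChartedSpace E M]
  {e e' : OpenPartialHomeomorph M E} {j : ℕ}

/-- The charts of `M` as a smooth manifold. -/
abbrev Charts (E : Type v) [NormedAddCommGroup E] [NormedSpace ℝ E]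
    (M : Type u) [TopologicalSpace M] [ChartedSpace E M] : Set (OpenPartialHomeomorph M E) :=
  IsManifold.maximalAtlas 𝓘(ℝ, E) ∞ M

theorem Charts.contMDiffAt (he : e ∈ Charts E M) {p : M} (hp : p ∈ e.source) :
    ContMDiffAt 𝓘(ℝ, E) 𝓘(ℝ, E) ∞ e p :=
  contMDiffAt_of_mem_maximalAtlas he hp

theorem Charts.contMDiffAt_symm (he : e ∈ Charts E M) {y : E} (hy : y ∈ e.target) :
    ContMDiffAt 𝓘(ℝ, E) 𝓘(ℝ, E) ∞ e.symm y :=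
  contMDiffAt_symm_of_mem_maximalAtlas he hy

theorem Charts.mdifferentiableAt (he : e ∈ Charts E M) {p : M} (hp : p ∈ e.source) :
    MDifferentiableAt 𝓘(ℝ, E) 𝓘(ℝ, E) e p :=
  (Charts.contMDiffAt he hp).mdifferentiableAt (by simp)

theorem Charts.mdifferentiableAt_symm (he : e ∈ Charts E M) {y : E} (hy : y ∈ e.target) :
    MDifferentiableAt 𝓘(ℝ, E) 𝓘(ℝ, E) e.symm y :=
  (Charts.contMDiffAt_symm he hy).mdifferentiableAt (by simp)

theorem Charts.D_comp_symm (he : e ∈ Charts E M) {y : E} (hy : y ∈ e.target) :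
    (D E E e (e.symm y)).comp (D E E e.symm y) = ContinuousLinearMap.id ℝ E := by
  rw [← D_comp (Charts.mdifferentiableAt he (e.map_target hy))
    (Charts.mdifferentiableAt_symm he hy), ← D_id (E := E) y]
  exact D_congr (Filter.eventually_of_mem (e.open_target.mem_nhds hy) fun z hz => e.right_inv hz)

theorem Charts.D_symm_comp (he : e ∈ Charts E M) {p : M} (hp : p ∈ e.source) :
    (D E E e.symm (e p)).comp (D E E e p) = ContinuousLinearMap.id ℝ E := by
  rw [← D_comp (Charts.mdifferentiableAt_symm he (e.map_source hp))
    (Charts.mdifferentiableAt he hp), ← D_id (E := E) p]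
  exact D_congr (Filter.eventually_of_mem (e.open_source.mem_nhds hp) fun z hz => e.left_inv hz)

/-- The pullback of a form under a map. -/
def Form.pull (φ : M → M) (η : Form E M j) : Form E M j :=
  fun p => (η (φ p)).compContinuousLinearMap (D E E φ p)

theorem Form.pull_id (η : Form E M j) : η.pull id = η := by
  funext p
  rw [Form.pull, D_id]
  rfl

/-- Near `y` the map `φ ∘ e.symm` factors through its coordinate expression followed by `e'.symm`.
Comparing the two chain rules turns the pullback on `M` into a pullback between open sets of `E`. -/
theorem Form.inChart_pull {φ : M → M} (η : Form E M j) (he : e ∈ Charts E M)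
    (he' : e' ∈ Charts E M) {y : E} (hy : y ∈ e.target)
    (hφ : MDifferentiableAt 𝓘(ℝ, E) 𝓘(ℝ, E) φ (e.symm y)) (hyφ : φ (e.symm y) ∈ e'.source) :
    (η.pull φ).inChart e y = (η.inChart e' ((e' ∘ φ ∘ e.symm) y)).compContinuousLinearMap
      (fderiv ℝ (e' ∘ φ ∘ e.symm) y) := by
  have hs := Charts.mdifferentiableAt_symm he hy
  have hφs : MDifferentiableAt 𝓘(ℝ, E) 𝓘(ℝ, E) (φ ∘ e.symm) y := hφ.comp y hs
  have hτ : MDifferentiableAt 𝓘(ℝ, E) 𝓘(ℝ, E) (e' ∘ φ ∘ e.symm) y :=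
    (Charts.mdifferentiableAt he' hyφ).comp y hφs
  have h1 := D_comp hφ hs
  have h2 : D E E (e'.symm ∘ (e' ∘ φ ∘ e.symm)) y = _ :=
    D_comp (Charts.mdifferentiableAt_symm he' (e'.map_source hyφ)) hτ
  have h3 : D E E (e'.symm ∘ (e' ∘ φ ∘ e.symm)) y = D E E (φ ∘ e.symm) y := by
    apply D_congr
    filter_upwards [hφs.continuousAt.preimage_mem_nhds (e'.open_source.mem_nhds hyφ)] with z hz
    exact e'.left_inv hz
  rw [h3, h1, D_eq_fderiv] at h2
  have h4 : e'.symm ((e' ∘ φ ∘ e.symm) y) = φ (e.symm y) := e'.left_inv hyφ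
  simp only [Form.inChart, Form.pull, comp_comp, h4]
  exact congrArg _ h2

/-- The form on the domain of a chart given by a form on the model space. -/
def Form.ofChart (e : OpenPartialHomeomorph M E) (θ : E → E [⋀^Fin j]→L[ℝ] ℝ) : Form E M j :=
  fun p => (θ (e p)).compContinuousLinearMap (D E E e p)

theorem Form.inChart_ofChart (he : e ∈ Charts E M) (θ : E → E [⋀^Fin j]→L[ℝ] ℝ) {y : E}
    (hy : y ∈ e.target) : (Form.ofChart e θ).inChart e y = θ y := by
  simp only [Form.inChart, Form.ofChart, comp_comp, e.right_inv hy]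
  have := Charts.D_comp_symm he hy
  rw [this]
  rfl

theorem Form.apply_eq_inChart (he : e ∈ Charts E M) (η : Form E M j) {p : M} (hp : p ∈ e.source) :
    η p = (η.inChart e (e p)).compContinuousLinearMap (D E E e p) := by
  simp only [Form.inChart, comp_comp, Charts.D_symm_comp he hp, e.left_inv hp]
  rfl

end Charts

/-! ### Pointwise smoothness and closedness, independent of charts -/

section Smooth

variable {E : Type v} [NormedAddCommGroup E] [NormedSpace ℝ E] [FiniteDimensional ℝ E]
  {M : Type u} [TopologicalSpace M] [ChartedSpace E M]
  {e e' : OpenPartialHomeomorph M E} {j : ℕ}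

theorem contDiffAt_transition (he : e ∈ Charts E M)
    (he' : e' ∈ Charts E M) {φ : M → M} {p : M} (hp : p ∈ e.source)
    (hφ : ContMDiffAt 𝓘(ℝ, E) 𝓘(ℝ, E) ∞ φ p) (hφp : φ p ∈ e'.source) :
    ContDiffAt ℝ ∞ (e' ∘ φ ∘ e.symm) (e p) := by
  rw [← contMDiffAt_iff_contDiffAt]
  have h1 : ContMDiffAt 𝓘(ℝ, E) 𝓘(ℝ, E) ∞ φ (e.symm (e p)) := by rwa [e.left_inv hp]
  have h2 : ContMDiffAt 𝓘(ℝ, E) 𝓘(ℝ, E) ∞ e' ((φ ∘ e.symm) (e p)) := by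
    simp only [Function.comp_apply, e.left_inv hp]
    exact Charts.contMDiffAt he' hφp
  exact h2.comp (e p) (h1.comp (e p) (Charts.contMDiffAt_symm he (e.map_source hp)))

theorem eventually_mdifferentiableAt [IsManifold 𝓘(ℝ, E) ∞ M] {F : Type*} [NormedAddCommGroup F]
    [NormedSpace ℝ F] {N : Type*} [TopologicalSpace N] [ChartedSpace F N] [IsManifold 𝓘(ℝ, F) ∞ N]
    {φ : M → N} {p : M} (hφ : ContMDiffAt 𝓘(ℝ, E) 𝓘(ℝ, F) ∞ φ p) :
    ∀ᶠ q in 𝓝 p, MDifferentiableAt 𝓘(ℝ, E) 𝓘(ℝ, F) φ q := by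
  have : IsManifold 𝓘(ℝ, E) 1 M := IsManifold.of_le (n := ∞) (by simp)
  have : IsManifold 𝓘(ℝ, F) 1 N := IsManifold.of_le (n := ∞) (by simp)
  have h1 : ContMDiffAt 𝓘(ℝ, E) 𝓘(ℝ, F) 1 φ p := hφ.of_le (by simp)
  filter_upwards [(contMDiffAt_iff_contMDiffAt_nhds (by simp)).1 h1] with q hq
  exact hq.mdifferentiableAt (by simp)

theorem inChart_pull_eventuallyEq [IsManifold 𝓘(ℝ, E) ∞ M] (η : Form E M j)
    (he : e ∈ Charts E M) (he' : e' ∈ Charts E M) {φ : M → M} {p : M} (hp : p ∈ e.source)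
    (hφ : ContMDiffAt 𝓘(ℝ, E) 𝓘(ℝ, E) ∞ φ p) (hφp : φ p ∈ e'.source) :
    (η.pull φ).inChart e =ᶠ[𝓝 (e p)] fun y =>
      (η.inChart e' ((e' ∘ φ ∘ e.symm) y)).compContinuousLinearMap
      (fderiv ℝ (e' ∘ φ ∘ e.symm) y) := by
  have h1 : ∀ᶠ q in 𝓝 p, MDifferentiableAt 𝓘(ℝ, E) 𝓘(ℝ, E) φ q ∧ φ q ∈ e'.source :=
    (eventually_mdifferentiableAt hφ).and
      (hφ.continuousAt.preimage_mem_nhds (e'.open_source.mem_nhds hφp))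
  have h2 : Filter.Tendsto e.symm (𝓝 (e p)) (𝓝 p) := by
    have := e.continuousAt_symm (e.map_source hp)
    rwa [ContinuousAt, e.left_inv hp] at this
  filter_upwards [h2.eventually h1, e.open_target.mem_nhds (e.map_source hp)] with y hy hy'
  exact Form.inChart_pull η he he' hy' hy.1 hy.2

theorem contDiffAt_inChart_pull [IsManifold 𝓘(ℝ, E) ∞ M] {η : Form E M j}
    (he : e ∈ Charts E M) (he' : e' ∈ Charts E M) {φ : M → M} {p : M} (hp : p ∈ e.source)
    (hφ : ContMDiffAt 𝓘(ℝ, E) 𝓘(ℝ, E) ∞ φ p) (hφp : φ p ∈ e'.source)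
    (hη : ContDiffAt ℝ ∞ (η.inChart e') (e' (φ p))) :
    ContDiffAt ℝ ∞ ((η.pull φ).inChart e) (e p) := by
  refine ContDiffAt.congr_of_eventuallyEq ?_ (inChart_pull_eventuallyEq η he he' hp hφ hφp)
  have hτ := contDiffAt_transition he he' hp hφ hφp
  have h0 : (e' ∘ φ ∘ e.symm) (e p) = e' (φ p) := by simp [e.left_inv hp]
  refine contDiffAt_comp_alternating ?_ (hτ.fderiv_right (m := ∞) (by simp))
  exact ContDiffAt.comp (e p) (by rwa [h0]) hτ

/-- Naturality of the exterior derivative, in coordinates. The case `φ = id` is the change of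
charts, so closedness may be checked in a single chart. -/
theorem extDeriv_inChart_pull [IsManifold 𝓘(ℝ, E) ∞ M] {η : Form E M j}
    (he : e ∈ Charts E M) (he' : e' ∈ Charts E M) {φ : M → M} {p : M} (hp : p ∈ e.source)
    (hφ : ContMDiffAt 𝓘(ℝ, E) 𝓘(ℝ, E) ∞ φ p) (hφp : φ p ∈ e'.source)
    (hη : ContDiffAt ℝ ∞ (η.inChart e') (e' (φ p))) :
    extDeriv ((η.pull φ).inChart e) (e p) =
      (extDeriv (η.inChart e') (e' (φ p))).compContinuousLinearMap
        (fderiv ℝ (e' ∘ φ ∘ e.symm) (e p)) := by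
  rw [(inChart_pull_eventuallyEq η he he' hp hφ hφp).extDeriv_eq]
  have hτ := contDiffAt_transition he he' hp hφ hφp
  have h0 : (e' ∘ φ ∘ e.symm) (e p) = e' (φ p) := by simp [e.left_inv hp]
  rw [extDeriv_pullback (r := ∞) _ hτ (by simp; exact WithTop.coe_le_coe.2 le_top), h0]
  rw [h0]
  exact hη.differentiableAt (by simp)

/-- A form is smooth at a point if its expression in some chart is smooth there. -/
def Form.SmoothAt (η : Form E M j) (p : M) : Prop :=
  ∃ e ∈ Charts E M, p ∈ e.source ∧ ContDiffAt ℝ ∞ (η.inChart e) (e p)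

/-- A form is closed at a point if the exterior derivative of its expression in every chart
vanishes there. -/
def Form.ClosedAt (η : Form E M j) (p : M) : Prop :=
  ∀ e ∈ Charts E M, p ∈ e.source → extDeriv (η.inChart e) (e p) = 0

variable [IsManifold 𝓘(ℝ, E) ∞ M] {η θ : Form E M j} {p : M}

/-- The definition of `Form.SmoothAt` provides one chart; pulling back along `id` transports
smoothness to every other chart. -/
theorem Form.SmoothAt.contDiffAt (h : η.SmoothAt p) (he : e ∈ Charts E M) (hp : p ∈ e.source) :
    ContDiffAt ℝ ∞ (η.inChart e) (e p) := by
  obtain ⟨e', he', hp', h'⟩ := h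
  have := contDiffAt_inChart_pull (φ := id) he he' hp contMDiffAt_id hp' h'
  rwa [Form.pull_id] at this

theorem Form.SmoothAt.pull {φ : M → M} (h : η.SmoothAt (φ p))
    (hφ : ContMDiffAt 𝓘(ℝ, E) 𝓘(ℝ, E) ∞ φ p) : (η.pull φ).SmoothAt p := by
  obtain ⟨e', he', hp', h'⟩ := h
  exact ⟨chartAt E p, IsManifold.chart_mem_maximalAtlas p, mem_chart_source E p,
    contDiffAt_inChart_pull (IsManifold.chart_mem_maximalAtlas p) he' (mem_chart_source E p)
      hφ hp' h'⟩

theorem Form.ClosedAt.pull {φ : M → M} (hs : η.SmoothAt (φ p)) (h : η.ClosedAt (φ p))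
    (hφ : ContMDiffAt 𝓘(ℝ, E) 𝓘(ℝ, E) ∞ φ p) : (η.pull φ).ClosedAt p := by
  obtain ⟨e', he', hp', h'⟩ := hs
  intro e he hp
  rw [extDeriv_inChart_pull he he' hp hφ hp' h', h e' he' hp']
  rfl

theorem Form.SmoothAt.closedAt (hs : η.SmoothAt p) (he : e ∈ Charts E M) (hp : p ∈ e.source)
    (h : extDeriv (η.inChart e) (e p) = 0) : η.ClosedAt p := by
  intro e' he' hp'
  have := extDeriv_inChart_pull (φ := id) he' he hp' contMDiffAt_id hp (hs.contDiffAt he hp)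
  rw [Form.pull_id] at this
  rw [this, id, h]
  rfl

theorem inChart_congr (h : η =ᶠ[𝓝 p] θ) (hp : p ∈ e.source) :
    η.inChart e =ᶠ[𝓝 (e p)] θ.inChart e := by
  have h2 : Filter.Tendsto e.symm (𝓝 (e p)) (𝓝 p) := by
    have := e.continuousAt_symm (e.map_source hp)
    rwa [ContinuousAt, e.left_inv hp] at this
  filter_upwards [h2.eventually h] with y hy
  simp only [Form.inChart, hy]

theorem Form.SmoothAt.congr (hs : η.SmoothAt p) (h : θ =ᶠ[𝓝 p] η) : θ.SmoothAt p := by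
  obtain ⟨e, he, hp, h'⟩ := hs
  exact ⟨e, he, hp, h'.congr_of_eventuallyEq (inChart_congr h hp)⟩

theorem Form.ClosedAt.congr (hs : η.ClosedAt p) (h : θ =ᶠ[𝓝 p] η) : θ.ClosedAt p := by
  intro e he hp
  rw [(inChart_congr h hp).extDeriv_eq, hs e he hp]

theorem Form.smoothOn_iff {U : Set M} (hU : IsOpen U) :
    η.SmoothOn U ↔ ∀ p ∈ U, η.SmoothAt p := by
  constructor
  · intro h p hp
    refine ⟨chartAt E p, IsManifold.chart_mem_maximalAtlas p, mem_chart_source E p, ?_⟩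
    refine (h _ (chart_mem_atlas E p)).contDiffAt ?_
    refine ((chartAt E p).isOpen_inter_preimage_symm hU).mem_nhds ⟨mem_chart_target E p, ?_⟩
    simpa using hp
  · rintro h e he y ⟨hy, hyU⟩
    have := (h _ hyU).contDiffAt (IsManifold.subset_maximalAtlas he) (e.map_target hy)
    rw [e.right_inv hy] at this
    exact this.contDiffWithinAt

theorem Form.closedOn_iff {U : Set M} (hs : ∀ p ∈ U, η.SmoothAt p) :
    η.ClosedOn U ↔ ∀ p ∈ U, η.ClosedAt p := by
  constructor
  · intro h p hp
    refine (hs p hp).closedAt (IsManifold.chart_mem_maximalAtlas p) (mem_chart_source E p) ?_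
    exact h _ (chart_mem_atlas E p) _ ⟨mem_chart_target E p, by simpa using hp⟩
  · rintro h e he y ⟨hy, hyU⟩
    have := h _ hyU e (IsManifold.subset_maximalAtlas he) (e.map_target hy)
    rwa [e.right_inv hy] at this

theorem Form.SmoothAt.add (h : η.SmoothAt p) (h' : θ.SmoothAt p) : (η + θ).SmoothAt p := by
  obtain ⟨e, he, hp, h⟩ := h
  exact ⟨e, he, hp, h.add (h'.contDiffAt he hp)⟩

theorem Form.SmoothAt.zero : Form.SmoothAt (0 : Form E M j) p :=
  ⟨chartAt E p, IsManifold.chart_mem_maximalAtlas p, mem_chart_source E p,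
    contDiffAt_const (c := (0 : E [⋀^Fin j]→L[ℝ] ℝ))⟩

theorem contDiffAt_function {F : Type*} [NormedAddCommGroup F] [NormedSpace ℝ F] {g : M → F}
    (hg : ContMDiffAt 𝓘(ℝ, E) 𝓘(ℝ, F) ∞ g p)
    (he : e ∈ Charts E M) (hp : p ∈ e.source) : ContDiffAt ℝ ∞ (g ∘ e.symm) (e p) := by
  rw [← contMDiffAt_iff_contDiffAt]
  have h1 : ContMDiffAt 𝓘(ℝ, E) 𝓘(ℝ, F) ∞ g (e.symm (e p)) := by rwa [e.left_inv hp]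
  exact h1.comp (e p) (Charts.contMDiffAt_symm he (e.map_source hp))

theorem Form.SmoothAt.smul {g : M → ℝ} (hg : ContMDiffAt 𝓘(ℝ, E) 𝓘(ℝ, ℝ) ∞ g p)
    (h : η.SmoothAt p) : Form.SmoothAt (fun q => g q • η q) p := by
  obtain ⟨e, he, hp, h⟩ := h
  exact ⟨e, he, hp, (contDiffAt_function hg he hp).smul h⟩

theorem Form.SmoothAt.sum {ι : Type*} (s : Finset ι) {η : ι → Form E M j}
    (h : ∀ i ∈ s, (η i).SmoothAt p) : Form.SmoothAt (fun q => ∑ i ∈ s, η i q) p := by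
  classical
  induction s using Finset.induction_on with
  | empty => exact Form.SmoothAt.zero
  | insert i s hi ih =>
    simp only [Finset.sum_insert hi]
    exact (h i (by simp)).add (ih fun k hk => h k (by simp [hk]))

/-- The form `dg ∧ η`. -/
def dWedge (g : M → ℝ) (η : Form E M j) : Form E M (j + 1) :=
  fun p => wedge (D E ℝ g p) (η p)

theorem inChart_dWedge {g : M → ℝ} (η : Form E M j) (he : e ∈ Charts E M) {y : E}
    (hy : y ∈ e.target) (hg : MDifferentiableAt 𝓘(ℝ, E) 𝓘(ℝ, ℝ) g (e.symm y)) :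
    (dWedge g η).inChart e y = wedge (fderiv ℝ (g ∘ e.symm) y) (η.inChart e y) := by
  simp only [Form.inChart, dWedge, wedge_comp]
  rw [← D_comp hg (Charts.mdifferentiableAt_symm he hy), D_eq_fderiv]

theorem inChart_dWedge_eventuallyEq {g : M → ℝ} (η : Form E M j)
    (hg : ContMDiffAt 𝓘(ℝ, E) 𝓘(ℝ, ℝ) ∞ g p) (he : e ∈ Charts E M) (hp : p ∈ e.source) :
    (dWedge g η).inChart e =ᶠ[𝓝 (e p)]
      fun y => wedge (fderiv ℝ (g ∘ e.symm) y) (η.inChart e y) := by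
  have h2 : Filter.Tendsto e.symm (𝓝 (e p)) (𝓝 p) := by
    have := e.continuousAt_symm (e.map_source hp)
    rwa [ContinuousAt, e.left_inv hp] at this
  filter_upwards [h2.eventually (eventually_mdifferentiableAt hg),
    e.open_target.mem_nhds (e.map_source hp)] with y hy hy'
  exact inChart_dWedge η he hy' hy

theorem Form.SmoothAt.dWedge {g : M → ℝ} (hg : ContMDiffAt 𝓘(ℝ, E) 𝓘(ℝ, ℝ) ∞ g p)
    (h : η.SmoothAt p) : (dWedge g η).SmoothAt p := by
  obtain ⟨e, he, hp, h⟩ := h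
  refine ⟨e, he, hp, ContDiffAt.congr_of_eventuallyEq ?_ (inChart_dWedge_eventuallyEq η hg he hp)⟩
  have h1 := (contDiffAt_function hg he hp).fderiv_right (m := ∞) (by simp)
  exact ((wedgeCLM E j).contDiff.contDiffAt.comp (e p) h1).clm_apply h

end Smooth

/-! ### Tubular neighbourhood of the zero set -/

section Tube

variable {E : Type v} [NormedAddCommGroup E] [NormedSpace ℝ E] [FiniteDimensional ℝ E]
  {M : Type u} [TopologicalSpace M] [ChartedSpace E M] [IsManifold 𝓘(ℝ, E) ∞ M]
  {x : M → ℝ}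

/-- The inverse function theorem makes `G` a local homeomorphism with inverse smooth at the image of
`e p`. Injectivity of the derivative is an open condition, and in finite dimension it means
invertibility, so after shrinking the domain the inverse is smooth everywhere and the composite is a
chart of the smooth structure. -/
theorem exists_chart_comp {e : OpenPartialHomeomorph M E} (he : e ∈ Charts E M) {p : M}
    (hp : p ∈ e.source) {G : E → E} (hG : ∀ᶠ y in 𝓝 (e p), ContDiffAt ℝ ∞ G y)
    (hinj : Function.Injective (fderiv ℝ G (e p))) :
    ∃ Ψ ∈ Charts E M, p ∈ Ψ.source ∧ Ψ.source ⊆ e.source ∧ ∀ q ∈ Ψ.source, Ψ q = G (e q) := by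
  have toEquiv : ∀ A : E →L[ℝ] E, Function.Injective A → ∃ B : E ≃L[ℝ] E, (B : E →L[ℝ] E) = A :=
    fun A hA => ⟨(LinearEquiv.ofInjectiveEndo (A : E →ₗ[ℝ] E) hA).toContinuousLinearEquiv,
      by ext v; rfl⟩
  have hG0 := hG.self_of_nhds
  obtain ⟨A, hA⟩ := toEquiv _ hinj
  have hd : HasFDerivAt G (A : E →L[ℝ] E) (e p) := by
    rw [hA]; exact (hG0.differentiableAt (by simp)).hasFDerivAt
  let g₀ := hG0.toOpenPartialHomeomorph G hd (by simp)
  have hg₀ : ∀ y, g₀ y = G y := fun y => rfl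
  have hp₀ : e p ∈ g₀.source := hG0.mem_toOpenPartialHomeomorph_source hd (by simp)
  have hinj' : ∀ᶠ y in 𝓝 (e p), Function.Injective (fderiv ℝ G y) := by
    have hc : ContinuousAt (fderiv ℝ G) (e p) :=
      (hG0.fderiv_right (m := 0) (by simp)).continuousAt
    exact hc.preimage_mem_nhds (ContinuousLinearMap.isOpen_injective.mem_nhds hinj)
  obtain ⟨O, hO, hOo, hpO⟩ := mem_nhds_iff.1 (hG.and hinj')
  let g := g₀.restrOpen O hOo
  have hgs : g.source = g₀.source ∩ O := g₀.restrOpen_source O hOo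
  refine ⟨e ≫ₕ g, ?_, ?_, ?_, ?_⟩
  · apply OpenPartialHomeomorph.mem_maximalAtlas_of_contMDiffOn
    · intro q hq
      rw [OpenPartialHomeomorph.trans_source, hgs] at hq
      have h1 : ContMDiffAt 𝓘(ℝ, E) 𝓘(ℝ, E) ∞ G (e q) :=
        contMDiffAt_iff_contDiffAt.2 (hO hq.2.2).1
      exact (h1.comp q (Charts.contMDiffAt he hq.1)).contMDiffWithinAt
    · intro y hy
      rw [OpenPartialHomeomorph.trans_target] at hy
      have hgy : g.symm y ∈ g₀.source ∩ O := hgs ▸ g.map_target hy.1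
      have hy₀ : y ∈ g₀.target := by
        have := g.right_inv hy.1
        rw [← this]
        exact g₀.map_source hgy.1
      have hsy : g.symm y = g₀.symm y := rfl
      obtain ⟨B, hB⟩ := toEquiv _ (hO hgy.2).2
      have h1 : ContDiffAt ℝ ∞ g.symm y := by
        refine g₀.contDiffAt_symm (f₀' := B) hy₀ ?_ (hO hgy.2).1
        rw [hB]
        exact ((hO hgy.2).1.differentiableAt (by simp)).hasFDerivAt
      exact ((Charts.contMDiffAt_symm he hy.2).comp y
        (contMDiffAt_iff_contDiffAt.2 h1)).contMDiffWithinAt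
  · rw [OpenPartialHomeomorph.trans_source, hgs]
    exact ⟨hp, hp₀, hpO⟩
  · rw [OpenPartialHomeomorph.trans_source]
    exact Set.inter_subset_left
  · intro q hq
    rfl

/-- In the chart `e` the function `x` is the linear form `ℓ`, and `w` is transverse to the
hyperplane `ℓ = 0`. -/
structure IsStraight (x : M → ℝ) (e : OpenPartialHomeomorph M E) (ℓ : E →L[ℝ] ℝ) (w : E) :
    Prop where
  chart : e ∈ Charts E M
  apply_w : ℓ w = 1
  eq : ∀ q ∈ e.source, x q = ℓ (e q)

theorem IsDefiningFunction.exists_straight (hx : IsDefiningFunction E x) {z : M} (hz : x z = 0) :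
    ∃ (e : OpenPartialHomeomorph M E) (ℓ : E →L[ℝ] ℝ) (w : E),
      IsStraight x e ℓ w ∧ z ∈ e.source := by
  let e := chartAt E z
  have he : e ∈ Charts E M := IsManifold.chart_mem_maximalAtlas z
  have hze : z ∈ e.source := mem_chart_source E z
  let X := x ∘ e.symm
  have hX : ∀ y ∈ e.target, ContDiffAt ℝ ∞ X y := fun y hy => by
    have := contDiffAt_function hx.smooth.contMDiffAt he (e.map_target hy)
    rwa [e.right_inv hy] at this
  let ℓ := fderiv ℝ X (e z)
  have hℓ : ℓ ≠ 0 := by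
    intro h
    apply hx.regular z hz
    have h1 : D E ℝ (X ∘ e) z = (D E ℝ X (e z)).comp (D E E e z) :=
      D_comp ((hX _ (e.map_source hze)).differentiableAt (by simp)).mdifferentiableAt
        (Charts.mdifferentiableAt he hze)
    have h2 : D E ℝ (X ∘ e) z = D E ℝ x z := by
      apply D_congr
      filter_upwards [e.open_source.mem_nhds hze] with q hq
      simp [X, e.left_inv hq]
    rw [← h2, h1, D_eq_fderiv]
    change ℓ.comp _ = 0
    rw [h, ContinuousLinearMap.zero_comp]
  obtain ⟨w₀, hw₀⟩ : ∃ w, ℓ w ≠ 0 := by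
    by_contra! h
    exact hℓ (ContinuousLinearMap.ext h)
  let w := (ℓ w₀)⁻¹ • w₀
  have hw : ℓ w = 1 := by simp [w, hw₀]
  -- Moving along `w` by the defect `X - ℓ` gives `ℓ ∘ G = X`. The defect has zero derivative at `e
  -- z`, so the derivative of `G` there is the identity.
  let G : E → E := fun y => y + (X y - ℓ y) • w
  have hG : ∀ y ∈ e.target, ContDiffAt ℝ ∞ G y := fun y hy =>
    contDiffAt_id.add (((hX y hy).sub ℓ.contDiff.contDiffAt).smul contDiffAt_const)
  have hG' : fderiv ℝ G (e z) = ContinuousLinearMap.id ℝ E := by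
    have h1 : HasFDerivAt X ℓ (e z) :=
      ((hX _ (e.map_source hze)).differentiableAt (by simp)).hasFDerivAt
    have h2 : HasFDerivAt G (ContinuousLinearMap.id ℝ E + (ℓ - ℓ).smulRight w) (e z) :=
      (hasFDerivAt_id (e z)).add ((h1.sub ℓ.hasFDerivAt).smul_const w)
    rw [h2.fderiv]
    ext v
    simp
  obtain ⟨Ψ, hΨ, hzΨ, hsub, hΨG⟩ := exists_chart_comp he hze
    (Filter.eventually_of_mem (e.open_target.mem_nhds (e.map_source hze)) hG)
    (by rw [hG']; exact fun _ _ h => h)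
  refine ⟨Ψ, ℓ, w, ⟨hΨ, hw, fun q hq => ?_⟩, hzΨ⟩
  rw [hΨG q hq]
  simp [G, hw, X, e.left_inv (hsub hq)]

/-- On the compact complement of the interior of `N` the function `|x|` attains a minimum, and this
is positive because the zero set lies in the interior. -/
theorem exists_lt_of_mem_nhds [CompactSpace M] (hx : Continuous x) {N : Set M}
    (hN : ∀ z, x z = 0 → N ∈ 𝓝 z) : ∃ δ > 0, ∀ p, |x p| < δ → p ∈ N := by
  rcases (interior N)ᶜ.eq_empty_or_nonempty with h | h
  · refine ⟨1, one_pos, fun p _ => interior_subset ?_⟩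
    by_contra hp
    exact Set.notMem_empty p (h ▸ hp)
  · have hc : IsCompact (interior N)ᶜ := isOpen_interior.isClosed_compl.isCompact
    obtain ⟨q, hq, hmin⟩ := hc.exists_isMinOn h hx.abs.continuousOn
    refine ⟨|x q|, abs_pos.2 fun h0 => hq (mem_interior_iff_mem_nhds.2 (hN q h0)), fun p hp => ?_⟩
    by_contra hpN
    exact absurd (hmin (a := p) fun h' => hpN (interior_subset h')) (not_le.2 hp)

/-- Moving the points near the zero set of `x` along the straight chart `e` by the amount `g`. -/
theorem exists_straight_move [T2Space M] (hx : IsDefiningFunction E x)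
    {e : OpenPartialHomeomorph M E} {ℓ : E →L[ℝ] ℝ} {w : E} (he : IsStraight x e ℓ w)
    {ρ : M → ℝ} (hρ : ContMDiff 𝓘(ℝ, E) 𝓘(ℝ, ℝ) ∞ ρ) (hsupp : tsupport ρ ⊆ e.source)
    {π : M → M} {g : M → ℝ}
    (hπ : ∀ z, x z = 0 → π z = z ∧ ∀ᶠ p in 𝓝 z,
      ContMDiffAt 𝓘(ℝ, E) 𝓘(ℝ, E) ∞ π p ∧ x (π p) = x p - g p * x p) :
    ∃ π' : M → M, ∀ z, x z = 0 → π' z = z ∧ ∀ᶠ p in 𝓝 z,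
      ContMDiffAt 𝓘(ℝ, E) 𝓘(ℝ, E) ∞ π' p ∧ x (π' p) = x p - (ρ p + g p) * x p := by
  classical
  -- Since `ℓ w = 1`, this translation lowers `x ∘ π` by exactly `ρ x`. Where `ρ` vanishes it does
  -- nothing, so the two branches of the new map fit together smoothly.
  let φ : M → M := fun p => e.symm (e (π p) - (ρ p * x p) • w)
  refine ⟨fun p => if p ∈ tsupport ρ then φ p else π p, fun z hz => ?_⟩
  obtain ⟨hπz, hev⟩ := hπ z hz
  have hcont : ContinuousAt π z := hev.self_of_nhds.1.continuousAt
  by_cases hzs : z ∈ tsupport ρ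
  · have hze := hsupp hzs
    have h1 : ∀ᶠ p in 𝓝 z, π p ∈ e.source :=
      hcont.preimage_mem_nhds (e.open_source.mem_nhds (by rwa [hπz]))
    have h2 : ∀ᶠ p in 𝓝 z, e (π p) - (ρ p * x p) • w ∈ e.target := by
      have hc : ContinuousAt (fun p => e (π p) - (ρ p * x p) • w) z := by
        refine ContinuousAt.sub (ContinuousAt.comp (g := e) ?_ hcont) ?_
        · rw [hπz]; exact e.continuousAt hze
        · exact ((hρ.continuous.mul hx.smooth.continuous).smul continuous_const).continuousAt
      refine hc.preimage_mem_nhds (e.open_target.mem_nhds ?_)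
      simp only [hπz, hz, mul_zero, zero_smul, sub_zero]
      exact e.map_source hze
    have h3 : ∀ᶠ p in 𝓝 z, (if p ∈ tsupport ρ then φ p else π p) = φ p := by
      filter_upwards [h1] with p hp
      split_ifs with hps
      · rfl
      · simp [φ, image_eq_zero_of_notMem_tsupport hps, e.left_inv hp]
    refine ⟨?_, ?_⟩
    · simp only [hzs, if_true, φ, hπz, hz, mul_zero, zero_smul, sub_zero, e.left_inv hze]
    · filter_upwards [hev, h1, h2, h3, h3.eventually_nhds] with p hp hp1 hp2 hp3 hp4
      refine ⟨ContMDiffAt.congr_of_eventuallyEq ?_ hp4, ?_⟩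
      · have h5 : ContMDiffAt 𝓘(ℝ, E) 𝓘(ℝ, E) ∞ (fun p => e (π p) - (ρ p * x p) • w) p := by
          refine ((Charts.contMDiffAt he.chart hp1).comp p hp.1).sub ?_
          exact (hρ.contMDiffAt.mul hx.smooth.contMDiffAt).smul contMDiffAt_const
        exact (Charts.contMDiffAt_symm he.chart hp2).comp p h5
      · rw [hp3, he.eq _ (e.map_target hp2), e.right_inv hp2, map_sub, map_smul, he.apply_w,
          ← he.eq _ hp1, hp.2]
        simp only [smul_eq_mul]
        ring
  · refine ⟨by simp only [hzs, if_false, hπz], ?_⟩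
    have h1 : ∀ᶠ p in 𝓝 z, p ∉ tsupport ρ := (isClosed_tsupport ρ).isOpen_compl.mem_nhds hzs
    filter_upwards [hev, h1, h1.eventually_nhds] with p hp hp1 hp2
    refine ⟨hp.1.congr_of_eventuallyEq ?_, ?_⟩
    · filter_upwards [hp2] with q hq using if_neg hq
    · rw [if_neg hp1, hp.2, image_eq_zero_of_notMem_tsupport hp1, zero_add]

/-- A smooth retraction of a neighbourhood of the zero set onto it. -/
theorem IsDefiningFunction.exists_retraction [T2Space M] [CompactSpace M]
    (hx : IsDefiningFunction E x) :
    ∃ π : M → M, ∀ z, x z = 0 → π z = z ∧ ∀ᶠ p in 𝓝 z,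
      ContMDiffAt 𝓘(ℝ, E) 𝓘(ℝ, E) ∞ π p ∧ x (π p) = 0 := by
  classical
  have hxc := hx.smooth.continuous
  have hZ : IsCompact {z : M | x z = 0} := (isClosed_eq hxc continuous_const).isCompact
  have htot : ∀ z, ∃ (e : OpenPartialHomeomorph M E) (ℓ : E →L[ℝ] ℝ) (w : E), x z = 0 →
      IsStraight x e ℓ w ∧ z ∈ e.source := fun z => by
    by_cases hz : x z = 0
    · obtain ⟨e, ℓ, w, h⟩ := hx.exists_straight hz
      exact ⟨e, ℓ, w, fun _ => h⟩
    · exact ⟨chartAt E z, 0, 0, fun h => absurd h hz⟩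
  choose e ℓ w hew using htot
  have he := fun z hz => (hew z hz).1
  have hze := fun z hz => (hew z hz).2
  obtain ⟨t, htZ, htc⟩ := hZ.elim_nhds_subcover (fun z => (e z).source)
    fun z hz => (e z).open_source.mem_nhds (hze z hz)
  obtain ⟨δ, hδ, hδt⟩ := exists_lt_of_mem_nhds hxc (N := ⋃ z ∈ t, (e z).source) fun z hz =>
    (isOpen_biUnion fun z _ => (e z).open_source).mem_nhds (htc hz)
  obtain ⟨ρ, hρ⟩ := SmoothPartitionOfUnity.exists_isSubordinate 𝓘(ℝ, E)
    (s := {p : M | |x p| ≤ δ / 2}) (isClosed_le hxc.abs continuous_const)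
    (fun z : t => (e z).source) (fun z => (e z).open_source) (by
      intro p hp
      have := hδt p (lt_of_le_of_lt hp (half_lt_self hδ))
      simp only [Set.mem_iUnion] at this ⊢
      obtain ⟨z, hz, h⟩ := this
      exact ⟨⟨z, hz⟩, h⟩)
  -- Each move adds one function of the partition of unity to the coefficient. When all have been
  -- used the coefficient is `1` near the zero set, and `x ∘ π = x - x = 0`.
  have key : ∀ s : Finset t, ∃ π : M → M, ∀ z, x z = 0 → π z = z ∧ ∀ᶠ p in 𝓝 z,
      ContMDiffAt 𝓘(ℝ, E) 𝓘(ℝ, E) ∞ π p ∧ x (π p) = x p - (∑ i ∈ s, ρ i p) * x p := by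
    intro s
    induction s using Finset.induction_on with
    | empty =>
      exact ⟨id, fun z _ => ⟨rfl, Filter.Eventually.of_forall fun p => ⟨contMDiffAt_id, by simp⟩⟩⟩
    | insert i s hi ih =>
      obtain ⟨π, hπ⟩ := ih
      simp only [Finset.sum_insert hi]
      exact exists_straight_move hx (he i (htZ i i.2)) (ρ i).contMDiff (hρ i) hπ
  obtain ⟨π, hπ⟩ := key Finset.univ
  refine ⟨π, fun z hz => ⟨(hπ z hz).1, ?_⟩⟩
  have h1 : ∀ᶠ p in 𝓝 z, |x p| < δ / 2 :=
    hxc.abs.continuousAt.eventually_lt continuousAt_const (by simp [hz, hδ])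
  filter_upwards [(hπ z hz).2, h1] with p hp hp1
  refine ⟨hp.1, ?_⟩
  have := ρ.sum_eq_one (x := p) hp1.le
  rw [finsum_eq_sum_of_fintype] at this
  rw [hp.2, this, one_mul, sub_self]

/-- A tubular neighbourhood `{|x| < δ}` of the zero set of `x` with projection `π`, and charts
in which `x` and `π` are linear. -/
structure Tube (E : Type v) [NormedAddCommGroup E] [NormedSpace ℝ E] {M : Type u}
    [TopologicalSpace M] [ChartedSpace E M] (x : M → ℝ) (δ : ℝ) (π : M → M) : Prop where
  smooth : ∀ p, |x p| < δ → ContMDiffAt 𝓘(ℝ, E) 𝓘(ℝ, E) ∞ π p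
  zero : ∀ p, |x p| < δ → x (π p) = 0
  fixed : ∀ p, x p = 0 → π p = p
  adapted : ∀ z, x z = 0 → ∃ (e : OpenPartialHomeomorph M E) (ℓ : E →L[ℝ] ℝ) (w : E),
    IsStraight x e ℓ w ∧ z ∈ e.source ∧
      ∀ᶠ p in 𝓝 z, π p ∈ e.source ∧ e (π p) = e p - ℓ (e p) • w
  bijOn : Set.BijOn (fun p => (π p, x p)) {p | |x p| < δ} ({z | x z = 0} ×ˢ Set.Ioo (-δ) δ)
  immersive : ∀ p, |x p| < δ → ∀ v : E, D E E π p v = 0 → D E ℝ x p v = 0 → v = 0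

/-- In a straight chart, `G = e ∘ π ∘ e.symm + ℓ • w` preserves `ℓ` near `e z` and is the identity
on the hyperplane `ℓ = 0`, hence is a local diffeomorphism. As `e (π p)` lies in that hyperplane,
`G` fixes it, and in the chart `G ∘ e` the retraction becomes `y ↦ y - ℓ y • w`. -/
theorem exists_adapted [T2Space M] (hx : IsDefiningFunction E x) {π : M → M}
    (hπ : ∀ z, x z = 0 → π z = z ∧ ∀ᶠ p in 𝓝 z,
      ContMDiffAt 𝓘(ℝ, E) 𝓘(ℝ, E) ∞ π p ∧ x (π p) = 0) {z : M} (hz : x z = 0) :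
    ∃ (e : OpenPartialHomeomorph M E) (ℓ : E →L[ℝ] ℝ) (w : E),
      IsStraight x e ℓ w ∧ z ∈ e.source ∧
      ∀ᶠ p in 𝓝 z, π p ∈ e.source ∧ e (π p) = e p - ℓ (e p) • w := by
  obtain ⟨e, ℓ, w, he, hze⟩ := hx.exists_straight hz
  obtain ⟨hπz, hev⟩ := hπ z hz
  have hcont : ContinuousAt π z := hev.self_of_nhds.1.continuousAt
  have h1 : ∀ᶠ p in 𝓝 z, π p ∈ e.source :=
    hcont.preimage_mem_nhds (e.open_source.mem_nhds (by rwa [hπz]))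
  have hsymm : Filter.Tendsto e.symm (𝓝 (e z)) (𝓝 z) := by
    have := e.continuousAt_symm (e.map_source hze)
    rwa [ContinuousAt, e.left_inv hze] at this
  let G : E → E := fun y => e (π (e.symm y)) + ℓ y • w
  have hGs : ∀ᶠ y in 𝓝 (e z), ContDiffAt ℝ ∞ G y := by
    filter_upwards [hsymm.eventually (hev.and h1), e.open_target.mem_nhds (e.map_source hze)]
      with y hy hyt
    refine ContDiffAt.add ?_ (ℓ.contDiff.contDiffAt.smul contDiffAt_const)
    have := contDiffAt_transition he.chart he.chart (e.map_target hyt) hy.1.1 hy.2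
    rwa [e.right_inv hyt] at this
  have hℓG : ∀ᶠ y in 𝓝 (e z), ℓ (G y) = ℓ y := by
    filter_upwards [hsymm.eventually (hev.and h1)] with y hy
    simp only [G, map_add, map_smul, he.apply_w, ← he.eq _ hy.2, hy.1.2, smul_eq_mul]
    ring
  have hGfix : ∀ y ∈ e.target, ℓ y = 0 → G y = y := by
    intro y hy h0
    have : x (e.symm y) = 0 := by rw [he.eq _ (e.map_target hy), e.right_inv hy, h0]
    simp only [G, h0, (hπ _ this).1, e.right_inv hy, zero_smul, add_zero]
  have hGd : HasFDerivAt G (fderiv ℝ G (e z)) (e z) :=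
    (hGs.self_of_nhds.differentiableAt (by simp)).hasFDerivAt
  have hz0 : ℓ (e z) = 0 := by rw [← he.eq z hze, hz]
  have hinj : Function.Injective (fderiv ℝ G (e z)) := by
    rw [injective_iff_map_eq_zero]
    intro v hv
    have hℓv : ℓ v = 0 := by
      have h2 : HasFDerivAt (fun y => ℓ (G y)) (ℓ.comp (fderiv ℝ G (e z))) (e z) :=
        ℓ.hasFDerivAt.comp (e z) hGd
      have h3 := (ℓ.hasFDerivAt (x := e z)).congr_of_eventuallyEq hℓG
      have := congrArg (fun L => L v) (h2.unique h3)
      simp only [ContinuousLinearMap.comp_apply, hv, map_zero] at this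
      exact this.symm
    -- A vector in the kernel of `dG` lies in `ker ℓ`. Along the line it spans through `e z` the map
    -- `G` is the identity, so `dG` fixes the vector, which is therefore zero.
    have hline : HasDerivAt (fun s : ℝ => e z + s • v) v 0 := by
      simpa using ((hasDerivAt_id (0 : ℝ)).smul_const v).const_add (e z)
    have h4 : HasDerivAt (fun s : ℝ => G (e z + s • v)) (fderiv ℝ G (e z) v) 0 := by
      refine HasFDerivAt.comp_hasDerivAt (l := G) (0 : ℝ) ?_ hline
      simpa using hGd
    have h5 : (fun s : ℝ => G (e z + s • v)) =ᶠ[𝓝 0] fun s : ℝ => e z + s • v := by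
      have hc : ContinuousAt (fun s : ℝ => e z + s • v) 0 := hline.continuousAt
      filter_upwards [hc.preimage_mem_nhds (e.open_target.mem_nhds (by
        simpa using e.map_source hze))] with s hs
      exact hGfix _ hs (by simp [hz0, hℓv])
    have h6 := h4.unique (hline.congr_of_eventuallyEq h5)
    rw [← h6, hv]
  obtain ⟨Ψ, hΨ, hzΨ, hsub, hΨG⟩ := exists_chart_comp he.chart hze hGs hinj
  have h2 : ∀ᶠ p in 𝓝 z, π p ∈ Ψ.source :=
    hcont.preimage_mem_nhds (Ψ.open_source.mem_nhds (by rwa [hπz]))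
  have hstr : ∀ᶠ p in 𝓝 z, ℓ (Ψ p) = x p := by
    filter_upwards [Ψ.open_source.mem_nhds hzΨ,
      (e.continuousAt hze).eventually hℓG] with p hp hp1
    rw [hΨG p hp, hp1, he.eq _ (hsub hp)]
  obtain ⟨O, hO, hOo, hzO⟩ := mem_nhds_iff.1 hstr
  -- The restriction to `O` makes `x = ℓ ∘ Ψ` hold on the whole domain of the chart.
  refine ⟨Ψ.restr O, ℓ, w, ⟨?_, he.apply_w, fun q hq => ?_⟩, ?_, ?_⟩
  · exact restr_mem_maximalAtlas (contDiffGroupoid ∞ 𝓘(ℝ, E)) hΨ hOo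
  · rw [Ψ.restr_source' O hOo] at hq
    exact (hO hq.2).symm
  · rw [Ψ.restr_source' O hOo]
    exact ⟨hzΨ, hzO⟩
  · rw [Ψ.restr_source' O hOo]
    have h3 : ∀ᶠ p in 𝓝 z, π p ∈ O := hcont.preimage_mem_nhds (hOo.mem_nhds (by rwa [hπz]))
    filter_upwards [h2, h3, hstr, hev, Ψ.open_source.mem_nhds hzΨ] with p hp hp1 hp2 hp3 hp4
    refine ⟨⟨hp, hp1⟩, ?_⟩
    change Ψ (π p) = Ψ p - ℓ (Ψ p) • w
    have h4 : e (π p) ∈ e.target := e.map_source (hsub hp)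
    have h5 : ℓ (e (π p)) = 0 := by rw [← he.eq _ (hsub hp), hp3.2]
    rw [hΨG _ hp, hGfix _ h4 h5, hp2, hΨG p hp4, he.eq p (hsub hp4)]
    simp only [G, e.left_inv (hsub hp4), add_sub_cancel_right]

theorem IsDefiningFunction.exists_tube [T2Space M] [CompactSpace M]
    (hx : IsDefiningFunction E x) :
    ∃ δ₀ > 0, ∃ π : M → M, ∀ δ, 0 < δ → δ ≤ δ₀ → Tube E x δ π := by
  obtain ⟨π, hπ⟩ := hx.exists_retraction
  have hxc := hx.smooth.continuous
  have hZ : IsCompact {z : M | x z = 0} := (isClosed_eq hxc continuous_const).isCompact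
  have hxd : ∀ p, MDifferentiableAt 𝓘(ℝ, E) 𝓘(ℝ, ℝ) x p := fun p =>
    hx.smooth.contMDiffAt.mdifferentiableAt (by simp)
  have htot : ∀ z, ∃ (e : OpenPartialHomeomorph M E) (ℓ : E →L[ℝ] ℝ) (w : E), x z = 0 →
      IsStraight x e ℓ w ∧ z ∈ e.source ∧
      ∀ᶠ p in 𝓝 z, π p ∈ e.source ∧ e (π p) = e p - ℓ (e p) • w := fun z => by
    by_cases hz : x z = 0
    · obtain ⟨e, ℓ, w, h⟩ := exists_adapted hx hπ hz
      exact ⟨e, ℓ, w, fun _ => h⟩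
    · exact ⟨chartAt E z, 0, 0, fun h => absurd h hz⟩
  choose e ℓ w hew using htot
  have he := fun z hz => (hew z hz).1
  have hze := fun z hz => (hew z hz).2.1
  have hadapt := fun z hz => (hew z hz).2.2
  have himm : ∀ z, x z = 0 → ∀ᶠ p in 𝓝 z,
      ∀ v : E, D E E π p v = 0 → D E ℝ x p v = 0 → v = 0 := by
    intro z hz
    filter_upwards [(hπ z hz).2, (hadapt z hz), (hadapt z hz).eventually_nhds,
      (e z).open_source.mem_nhds (hze z hz)] with p hp hp1 hp2 hps v hv hv'
    have hsrc := (e z).open_source.mem_nhds hps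
    -- The chart is recovered from `π` and `x`, so a vector killed by both differentials is killed
    -- by the differential of the chart.
    have h1 : (e z : M → E) =ᶠ[𝓝 p] fun q => (e z ∘ π) q + x q • w z := by
      filter_upwards [hp2, hsrc] with q hq hq1
      rw [Function.comp_apply, hq.2, ← (he z hz).eq q hq1, sub_add_cancel]
    have hd1 : HasMFDerivAt 𝓘(ℝ, E) 𝓘(ℝ, E) (e z ∘ π) p
        ((D E E (e z) (π p)).comp (D E E π p)) :=
      (Charts.mdifferentiableAt (he z hz).chart hp1.1).hasMFDerivAt.comp p
        (hp.1.mdifferentiableAt (by simp)).hasMFDerivAt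
    have hd2 : HasMFDerivAt 𝓘(ℝ, E) 𝓘(ℝ, E) (fun q => x q • w z) p
        ((D E ℝ x p).smulRight (w z)) := by
      have h3 : HasMFDerivAt 𝓘(ℝ, ℝ) 𝓘(ℝ, E) (fun t : ℝ => t • w z) (x p)
          ((ContinuousLinearMap.id ℝ ℝ).smulRight (w z)) :=
        ((hasFDerivAt_id (x p)).smul_const (w z)).hasMFDerivAt
      exact h3.comp p (hxd p).hasMFDerivAt
    have hd : D E E (e z) p = (D E E (e z) (π p)).comp (D E E π p) +
        (D E ℝ x p).smulRight (w z) := by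
      rw [D_congr h1]
      exact (hd1.add hd2).mfderiv
    have h4 : D E E (e z) p v = 0 := by
      rw [hd]
      simp [hv, hv']
    have h5 := congrArg (fun L : E →L[ℝ] E => L v) (Charts.D_symm_comp (he z hz).chart hps)
    simp only [ContinuousLinearMap.comp_apply, h4, map_zero] at h5
    exact h5.symm
  -- The map `(π, x)` is injective on the compact zero set, where `π` is the identity, and locally
  -- injective around each of its points; together these give injectivity on a neighbourhood.
  obtain ⟨N, hN, hinj⟩ : ∃ N ∈ 𝓝ˢ {z : M | x z = 0}, Set.InjOn (fun p => (π p, x p)) N := by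
    refine Set.InjOn.exists_mem_nhdsSet ?_ hZ ?_ ?_
    · intro z hz z' hz' h
      have : π z = π z' := (Prod.ext_iff.1 h).1
      rwa [(hπ z hz).1, (hπ z' hz').1] at this
    · intro z hz
      exact (hπ z hz).2.self_of_nhds.1.continuousAt.prodMk hxc.continuousAt
    · intro z hz
      refine ⟨_, (hadapt z hz).and ((e z).open_source.mem_nhds (hze z hz)), ?_⟩
      rintro p ⟨⟨_, hp⟩, hps⟩ q ⟨⟨_, hq⟩, hqs⟩ h
      obtain ⟨h1, h2⟩ := Prod.ext_iff.1 h
      simp only at h1 h2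
      refine (e z).injOn hps hqs ?_
      rw [h1, hq, ← (he z hz).eq p hps, ← (he z hz).eq q hqs, h2] at hp
      exact (sub_left_injective hp).symm
  -- In an adapted chart the point over `(z, t)` is `z` translated by `t • w`. The condition `x z =
  -- 0` is repeated inside the statement because the compactness argument lets `z` range over a full
  -- neighbourhood of a point of the zero set.
  have hsurj : ∀ᶠ t in 𝓝 (0 : ℝ), ∀ z ∈ {z : M | x z = 0},
      x z = 0 → ∃ p, π p = z ∧ x p = t := by
    refine hZ.eventually_forall_of_forall_eventually fun z₀ hz₀ => ?_
    have hz₀' : x z₀ = 0 := hz₀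
    have hstr := he z₀ hz₀
    let F : ℝ × M → E := fun q => e z₀ q.2 + q.1 • w z₀
    have hF0 : F (0, z₀) = e z₀ z₀ := by simp [F]
    have hFc : ContinuousAt F (0, z₀) := by
      refine ContinuousAt.add ?_ ?_
      · exact ContinuousAt.comp (g := e z₀) ((e z₀).continuousAt (hze z₀ hz₀)) continuousAt_snd
      · exact (continuous_fst.smul continuous_const).continuousAt
    have ht : ∀ᶠ q in 𝓝 ((0 : ℝ), z₀), F q ∈ (e z₀).target :=
      hFc.preimage_mem_nhds ((e z₀).open_target.mem_nhds
        (hF0 ▸ (e z₀).map_source (hze z₀ hz₀)))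
    have hsymm : Filter.Tendsto (fun q => (e z₀).symm (F q)) (𝓝 (0, z₀)) (𝓝 z₀) := by
      have h1 := (e z₀).continuousAt_symm ((e z₀).map_source (hze z₀ hz₀))
      rw [ContinuousAt, (e z₀).left_inv (hze z₀ hz₀)] at h1
      have h2 : Filter.Tendsto F (𝓝 (0, z₀)) (𝓝 (e z₀ z₀)) := hF0 ▸ hFc
      exact h1.comp h2
    have hsrc : ∀ᶠ q in 𝓝 ((0 : ℝ), z₀), q.2 ∈ (e z₀).source :=
      continuousAt_snd.preimage_mem_nhds ((e z₀).open_source.mem_nhds (hze z₀ hz₀))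
    filter_upwards [ht, hsymm.eventually (hadapt z₀ hz₀), hsrc] with q hq1 hq2 hq3 hq4
    have hℓ : ℓ z₀ (F q) = q.1 := by
      have : ℓ z₀ (e z₀ q.2) = 0 := by rw [← hstr.eq _ hq3, hq4]
      simp [F, this, hstr.apply_w]
    refine ⟨(e z₀).symm (F q), ?_, ?_⟩
    · refine (e z₀).injOn hq2.1 hq3 ?_
      rw [hq2.2, (e z₀).right_inv hq1, hℓ]
      simp [F]
    · rw [hstr.eq _ ((e z₀).map_target hq1), (e z₀).right_inv hq1, hℓ]
  obtain ⟨δ₁, hδ₁, hs⟩ := Metric.eventually_nhds_iff.1 hsurj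
  obtain ⟨δ₂, hδ₂, hn⟩ := exists_lt_of_mem_nhds hxc (N := {p | p ∈ N ∧
      (ContMDiffAt 𝓘(ℝ, E) 𝓘(ℝ, E) ∞ π p ∧ x (π p) = 0) ∧
      ∀ v : E, D E E π p v = 0 → D E ℝ x p v = 0 → v = 0}) fun z hz => by
    have hNz : ∀ᶠ p in 𝓝 z, p ∈ N := mem_nhdsSet_iff_forall.1 hN z hz
    exact hNz.and ((hπ z hz).2.and (himm z hz))
  refine ⟨min δ₁ δ₂, lt_min hδ₁ hδ₂, π, fun δ hδ hδle => ?_⟩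
  have hn' : ∀ p, |x p| < δ → _ := fun p hp => hn p (hp.trans_le (hδle.trans (min_le_right _ _)))
  refine ⟨fun p hp => (hn' p hp).2.1.1, fun p hp => (hn' p hp).2.1.2, fun p hp => (hπ p hp).1,
    fun z hz => ⟨e z, ℓ z, w z, he z hz, hze z hz, hadapt z hz⟩, ⟨?_, ?_, ?_⟩,
    fun p hp => (hn' p hp).2.2⟩
  · intro p hp
    exact ⟨(hn' p hp).2.1.2, abs_lt.1 hp⟩
  · exact hinj.mono fun p hp => (hn' p hp).1
  · rintro ⟨z, t⟩ ⟨hz, ht⟩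
    have ht' : |t| < δ := abs_lt.2 ht
    obtain ⟨p, hp, hpt⟩ := hs (y := t) (by
      rw [Real.dist_0_eq_abs]; exact ht'.trans_le (hδle.trans (min_le_left _ _))) z hz hz
    exact ⟨p, by simp only [Set.mem_ofPred_eq, hpt, ht'], by simp only [hp, hpt]⟩

end Tube

/-! ### Integrals with parameters and Hadamard's lemma -/

section Hadamard

variable {E : Type v} [NormedAddCommGroup E] [NormedSpace ℝ E] [FiniteDimensional ℝ E]

/-- Differentiation under the integral sign, by induction on `n`. The target `F` must vary in the
induction, since the derivative takes values in `E →L[ℝ] F`. -/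
theorem contDiff_nat_intervalIntegral (n : ℕ) : ∀ {F : Type v} [NormedAddCommGroup F]
    [NormedSpace ℝ F] [CompleteSpace F] {G : E × ℝ → F}, ContDiff ℝ n G →
    ContDiff ℝ n fun y => ∫ s in (0 : ℝ)..1, G (y, s) := by
  induction n with
  | zero =>
    intro F _ _ _ G hG
    have hc : Continuous (Function.uncurry fun (y : E) (s : ℝ) => G (y, s)) := hG.continuous
    exact contDiff_zero.2 (intervalIntegral.continuous_parametric_intervalIntegral_of_continuous'
      hc 0 1)
  | succ n ih =>
    intro F _ _ _ G hG
    let G' : E × ℝ → E →L[ℝ] F := fun q => (fderiv ℝ G q).comp (ContinuousLinearMap.inl ℝ E ℝ)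
    have hG' : ContDiff ℝ n G' := (hG.fderiv_right (m := n) (by simp)).clm_comp contDiff_const
    have hd : ∀ y s, HasFDerivAt (fun z => G (z, s)) (G' (y, s)) y := fun y s =>
      HasFDerivAt.comp y ((hG.differentiable (by simp)) (y, s)).hasFDerivAt
        (hasFDerivAt_prodMk_left y s)
    refine contDiff_succ_iff_hasFDerivAt.2 ⟨fun y => ∫ s in (0 : ℝ)..1, G' (y, s), ih hG',
      fun y => ?_⟩
    obtain ⟨C, hC⟩ := ((isCompact_closedBall y 1).prod
      (isCompact_Icc (a := (0 : ℝ)) (b := 1))).exists_bound_of_continuousOn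
        hG'.continuous.continuousOn
    have hsec : ∀ {F' : Type v} [NormedAddCommGroup F'] {H : E × ℝ → F'}, Continuous H →
        ∀ z, Continuous fun s => H (z, s) := fun hH z => hH.comp (by fun_prop)
    refine intervalIntegral.hasFDerivAt_integral_of_dominated_of_fderiv_le
      (F := fun z s => G (z, s)) (F' := fun z s => G' (z, s)) (bound := fun _ => C)
      (Metric.closedBall_mem_nhds y one_pos) ?_ ?_ ?_ ?_ ?_ ?_
    · exact Filter.Eventually.of_forall fun z => (hsec hG.continuous z).aestronglyMeasurable
    · exact (hsec hG.continuous y).intervalIntegrable _ _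
    · exact (hsec hG'.continuous y).aestronglyMeasurable
    · refine Filter.Eventually.of_forall fun s hs z hz => hC (z, s) ⟨hz, ?_⟩
      rw [Set.uIoc_of_le zero_le_one] at hs
      exact Set.Ioc_subset_Icc_self hs
    · exact intervalIntegrable_const
    · exact Filter.Eventually.of_forall fun s _ z _ => hd z s

theorem contDiff_intervalIntegral {F : Type v} [NormedAddCommGroup F]
    [NormedSpace ℝ F] [CompleteSpace F] {G : E × ℝ → F} (hG : ContDiff ℝ ∞ G) :
    ContDiff ℝ ∞ fun y => ∫ s in (0 : ℝ)..1, G (y, s) :=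
  contDiff_infty.2 fun n => contDiff_nat_intervalIntegral n (hG.of_le (by exact_mod_cast le_top))

/-- Hadamard's lemma. -/
theorem exists_smooth_quotient {F : Type v} [NormedAddCommGroup F]
    [NormedSpace ℝ F] [CompleteSpace F] {θ : E → F} (hθ : ContDiff ℝ ∞ θ) (ℓ : E →L[ℝ] ℝ) (w : E) :
    ∃ θ' : E → F, ContDiff ℝ ∞ θ' ∧ ∀ y, θ y = θ (y - ℓ y • w) + ℓ y • θ' y := by
  -- The segment from the projection of `y` to the hyperplane `ℓ = 0`, at parameter `0`, to `y`, at
  -- parameter `1`.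
  let γ : E × ℝ → E := fun q => q.1 - ℓ q.1 • w + (q.2 * ℓ q.1) • w
  have hγ : ContDiff ℝ ∞ γ := by fun_prop
  have hθ' : ContDiff ℝ ∞ (fderiv ℝ θ) := hθ.fderiv_right (by simp)
  have hG : ContDiff ℝ ∞ fun q => fderiv ℝ θ (γ q) w := (hθ'.comp hγ).clm_apply contDiff_const
  refine ⟨fun y => ∫ s in (0 : ℝ)..1, fderiv ℝ θ (γ (y, s)) w, contDiff_intervalIntegral hG,
    fun y => ?_⟩
  have hd : ∀ s : ℝ, HasDerivAt (fun s => θ (γ (y, s))) (ℓ y • fderiv ℝ θ (γ (y, s)) w) s := by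
    intro s
    have h1 : HasDerivAt (fun s => γ (y, s)) (ℓ y • w) s := by
      have := (((hasDerivAt_id s).mul_const (ℓ y)).smul_const w).const_add (y - ℓ y • w)
      simpa [γ] using this
    have h2 := (hθ.differentiable (by simp) (γ (y, s))).hasFDerivAt.comp_hasDerivAt s h1
    rwa [map_smul] at h2
  have h3 := intervalIntegral.integral_eq_sub_of_hasDerivAt (a := 0) (b := 1) (fun s _ => hd s)
    ((continuous_const.smul (hG.continuous.comp (by fun_prop : Continuous fun s : ℝ =>
      (y, s)))).intervalIntegrable _ _)
  rw [intervalIntegral.integral_smul] at h3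
  rw [h3]
  simp [γ]

end Hadamard

/-! ### Linear algebra of one- and two-covectors -/

section Covectors

variable {V : Type*} [NormedAddCommGroup V] [NormedSpace ℝ V]

theorem ext_two {a b : V [⋀^Fin 2]→L[ℝ] ℝ} (h : ∀ v w, a ![v, w] = b ![v, w]) : a = b := by
  ext v
  have : v = ![v 0, v 1] := by ext i; fin_cases i <;> rfl
  rw [this]
  exact h _ _

theorem one_add (a : V [⋀^Fin 1]→L[ℝ] ℝ) (v w : V) : a ![v + w] = a ![v] + a ![w] := by
  have h := a.map_update_add ![v] 0 v w
  have hu : ∀ u, Function.update ![v] 0 u = ![u] := fun u => by ext i; fin_cases i; simp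
  rwa [hu, hu, hu] at h

theorem one_smul_vec (a : V [⋀^Fin 1]→L[ℝ] ℝ) (c : ℝ) (v : V) : a ![c • v] = c * a ![v] := by
  have h := a.map_update_smul ![v] 0 c v
  have hu : ∀ u, Function.update ![v] 0 u = ![u] := fun u => by ext i; fin_cases i; simp
  rwa [hu, hu] at h

theorem comp_one_apply {W : Type*} [NormedAddCommGroup W] [NormedSpace ℝ W]
    (a : V [⋀^Fin 1]→L[ℝ] ℝ) (L : W →L[ℝ] V) (v : W) :
    a.compContinuousLinearMap L ![v] = a ![L v] := by
  rw [ContinuousAlternatingMap.compContinuousLinearMap_apply]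
  congr 1
  ext i; fin_cases i; rfl

theorem comp_two_apply {W : Type*} [NormedAddCommGroup W] [NormedSpace ℝ W]
    (a : V [⋀^Fin 2]→L[ℝ] ℝ) (L : W →L[ℝ] V) (v v' : W) :
    a.compContinuousLinearMap L ![v, v'] = a ![L v, L v'] := by
  rw [ContinuousAlternatingMap.compContinuousLinearMap_apply]
  congr 1
  ext i; fin_cases i <;> rfl

/-- The projection to the hyperplane `ℓ = 0` along `w`. -/
def hproj (ℓ : V →L[ℝ] ℝ) (w : V) : V →L[ℝ] V :=
  ContinuousLinearMap.id ℝ V - ℓ.smulRight w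

theorem hproj_apply (ℓ : V →L[ℝ] ℝ) (w v : V) : hproj ℓ w v = v - ℓ v • w := rfl

/-- A covector vanishing on `ker ℓ` is a multiple of `ℓ`. -/
theorem wedge_eq_zero_of_ker {ℓ : V →L[ℝ] ℝ} {w : V} (hw : ℓ w = 1) {a : V [⋀^Fin 1]→L[ℝ] ℝ}
    (h : ∀ v, ℓ v = 0 → a ![v] = 0) : wedge ℓ a = 0 := by
  have key : ∀ v, a ![v] = ℓ v * a ![w] := fun v => by
    have h1 := h (v - ℓ v • w) (by simp [hw])
    have h2 := one_add a (v - ℓ v • w) (ℓ v • w)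
    rw [sub_add_cancel, h1, one_smul_vec, zero_add] at h2
    exact h2
  refine ext_two fun v v' => ?_
  rw [wedge_one_apply, key v, key v']
  change _ = (0 : ℝ)
  ring

end Covectors

/-! ### Pointwise values of `b^m`-forms -/

section BForms

variable {E : Type v} [NormedAddCommGroup E] [NormedSpace ℝ E]
  {M : Type u} [TopologicalSpace M] [ChartedSpace E M]

/-- The value at a point of the `b^m`-form `(dx / x^m) ∧ a + b`. -/
def bAt (x : M → ℝ) (m : ℕ) (p : M) (a : E [⋀^Fin 1]→L[ℝ] ℝ) (b : E [⋀^Fin 2]→L[ℝ] ℝ) :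
    bTangent E x m p [⋀^Fin 2]→L[ℝ] ℝ :=
  (wedge (ContinuousLinearMap.snd ℝ E ℝ)
        (a.compContinuousLinearMap (ContinuousLinearMap.fst ℝ E ℝ)) +
      b.compContinuousLinearMap (ContinuousLinearMap.fst ℝ E ℝ)).compContinuousLinearMap
      (bTangent E x m p).subtypeL

theorem bFormOf_eq (x : M → ℝ) (m : ℕ) (p : M) (α : Form E M 1) (β : Form E M 2) :
    bFormOf x m α β p = bAt x m p (α p) (β p) := rfl

theorem bAt_apply (x : M → ℝ) (m : ℕ) (p : M) (a : E [⋀^Fin 1]→L[ℝ] ℝ) (b : E [⋀^Fin 2]→L[ℝ] ℝ)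
    (u u' : bTangent E x m p) : bAt x m p a b ![u, u'] =
      (u : E × ℝ).2 * a ![(u' : E × ℝ).1] - (u' : E × ℝ).2 * a ![(u : E × ℝ).1] +
        b ![(u : E × ℝ).1, (u' : E × ℝ).1] := by
  rw [bAt, comp_two_apply, ContinuousAlternatingMap.add_apply, wedge_one_apply, comp_two_apply,
    comp_one_apply, comp_one_apply]
  rfl

/-- The value `bAt x m p a b` is linear in `(a, b)`. Convexity is what allows local representatives
to be averaged with a partition of unity. -/
theorem bAt_convex (x : M → ℝ) (m : ℕ) (p : M) (c : bTangent E x m p [⋀^Fin 2]→L[ℝ] ℝ) :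
    Convex ℝ {ab : (E [⋀^Fin 1]→L[ℝ] ℝ) × (E [⋀^Fin 2]→L[ℝ] ℝ) | c = bAt x m p ab.1 ab.2} := by
  rintro ⟨a, b⟩ h ⟨a', b'⟩ h' s t _ _ hst
  simp only [Set.mem_ofPred_eq] at *
  refine ext_two fun u u' => ?_
  have h1 : c ![u, u'] = s * c ![u, u'] + t * c ![u, u'] := by rw [← add_mul, hst, one_mul]
  rw [h1]
  nth_rw 1 [h]
  nth_rw 1 [h']
  simp only [bAt_apply, Prod.fst_add, Prod.snd_add, Prod.smul_fst, Prod.smul_snd,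
    ContinuousAlternatingMap.add_apply, ContinuousAlternatingMap.smul_apply, smul_eq_mul]
  ring

end BForms

/-! ### Gluing by partitions of unity -/

section Glue

variable {E : Type v} [NormedAddCommGroup E] [NormedSpace ℝ E] [FiniteDimensional ℝ E]
  {M : Type u} [TopologicalSpace M] [ChartedSpace E M] [IsManifold 𝓘(ℝ, E) ∞ M]
  [T2Space M] [CompactSpace M] {x : M → ℝ}

theorem Form.SmoothAt.smul_of_tsupport {j : ℕ} {η : Form E M j} {ρ : M → ℝ} {p : M}
    (hρ : ContMDiff 𝓘(ℝ, E) 𝓘(ℝ, ℝ) ∞ ρ) (h : p ∈ tsupport ρ → η.SmoothAt p) :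
    Form.SmoothAt (fun q => ρ q • η q) p := by
  by_cases hp : p ∈ tsupport ρ
  · exact (h hp).smul hρ.contMDiffAt
  · refine Form.SmoothAt.zero.congr ?_
    filter_upwards [notMem_tsupport_iff_eventuallyEq.1 hp] with q hq
    simp [hq]

/-- Gluing pairs of forms which satisfy a pointwise convex condition. -/
theorem exists_glue {i j : ℕ} {K : Set M} (hK : IsClosed K)
    (C : M → Set ((E [⋀^Fin i]→L[ℝ] ℝ) × (E [⋀^Fin j]→L[ℝ] ℝ))) (hC : ∀ p, Convex ℝ (C p))
    (hloc : ∀ q ∈ K, ∃ V : Set M, IsOpen V ∧ q ∈ V ∧ ∃ (α : Form E M i) (β : Form E M j),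
      (∀ p ∈ V, α.SmoothAt p) ∧ (∀ p ∈ V, β.SmoothAt p) ∧ ∀ p ∈ V, (α p, β p) ∈ C p) :
    ∃ (α : Form E M i) (β : Form E M j),
      (∀ p, α.SmoothAt p) ∧ (∀ p, β.SmoothAt p) ∧ ∀ p ∈ K, (α p, β p) ∈ C p := by
  choose V hVo hqV α β hα hβ hC' using fun q : K => hloc q q.2
  obtain ⟨t, ht⟩ := hK.isCompact.elim_finite_subcover V hVo
    fun q hq => Set.mem_iUnion.2 ⟨⟨q, hq⟩, hqV ⟨q, hq⟩⟩
  obtain ⟨ρ, hρ⟩ := SmoothPartitionOfUnity.exists_isSubordinate 𝓘(ℝ, E) hK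
    (fun q : t => V q) (fun q => hVo q) (by
      intro p hp
      have := ht hp
      simp only [Set.mem_iUnion] at this ⊢
      obtain ⟨q, hq, h⟩ := this
      exact ⟨⟨q, hq⟩, h⟩)
  refine ⟨fun p => ∑ q : t, ρ q p • α q p, fun p => ∑ q : t, ρ q p • β q p, fun p => ?_,
    fun p => ?_, fun p hp => ?_⟩
  · exact Form.SmoothAt.sum (η := fun (q : t) p => ρ q p • α q p) _ fun q _ =>
      Form.SmoothAt.smul_of_tsupport (ρ q).contMDiff fun h => hα q p (hρ q h)
  · exact Form.SmoothAt.sum (η := fun (q : t) p => ρ q p • β q p) _ fun q _ =>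
      Form.SmoothAt.smul_of_tsupport (ρ q).contMDiff fun h => hβ q p (hρ q h)
  · have h1 : ∑ᶠ q : t, ρ q p • (α q p, β q p) ∈ C p :=
      (hC p).finsum_mem (fun q => ρ.nonneg q p) (ρ.sum_eq_one hp) fun q hq =>
        hC' q p (hρ q (subset_tsupport _ hq))
    rw [finsum_eq_sum_of_fintype] at h1
    convert h1 using 1
    refine Prod.ext ?_ ?_
    · rw [Prod.fst_sum]; rfl
    · rw [Prod.snd_sum]; rfl

theorem BForm.Smooth.exists_global {m : ℕ} {Ω : BForm E x m} (h : Ω.Smooth) :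
    ∃ (α : Form E M 1) (β : Form E M 2), (∀ p, α.SmoothAt p) ∧ (∀ p, β.SmoothAt p) ∧
      ∀ p, Ω p = bAt x m p (α p) (β p) := by
  obtain ⟨α, β, hα, hβ, hC⟩ := exists_glue isClosed_univ
    (fun p => {ab | Ω p = bAt x m p ab.1 ab.2}) (fun p => bAt_convex x m p (Ω p)) fun q _ => by
      obtain ⟨V, hV, hq, α, β, hα, hβ, h⟩ := h q
      exact ⟨V, hV, hq, α, β, (Form.smoothOn_iff hV).1 hα, (Form.smoothOn_iff hV).1 hβ, h⟩
  exact ⟨α, β, hα, hβ, fun p => hC p trivial⟩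

end Glue

/-! ### Division by `x` and the transverse expansion of a one-form -/

section Division

variable {E : Type v} [NormedAddCommGroup E] [NormedSpace ℝ E] [FiniteDimensional ℝ E]
  {M : Type u} [TopologicalSpace M] [ChartedSpace E M] [IsManifold 𝓘(ℝ, E) ∞ M]
  {x : M → ℝ} {δ : ℝ} {π : M → M}

/-- On the open set `V` the chart `e` makes `x` and the projection `π` linear. -/
structure AdaptedOn (x : M → ℝ) (π : M → M) (e : OpenPartialHomeomorph M E) (ℓ : E →L[ℝ] ℝ)
    (w : E) (V : Set M) : Prop extends IsStraight x e ℓ w where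
  isOpen : IsOpen V
  subset : V ⊆ e.source
  smooth : ∀ p ∈ V, ContMDiffAt 𝓘(ℝ, E) 𝓘(ℝ, E) ∞ π p
  mapsTo : ∀ p ∈ V, π p ∈ e.source
  map_eq : ∀ p ∈ V, e (π p) = hproj ℓ w (e p)

theorem Tube.exists_adaptedOn (hT : Tube E x δ π) (hδ : 0 < δ) (hxc : Continuous x) {z : M}
    (hz : x z = 0) :
    ∃ (e : OpenPartialHomeomorph M E) (ℓ : E →L[ℝ] ℝ) (w : E) (V : Set M),
      z ∈ V ∧ AdaptedOn x π e ℓ w V := by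
  obtain ⟨e, ℓ, w, he, hze, hev⟩ := hT.adapted z hz
  have h1 : ∀ᶠ p in 𝓝 z, |x p| < δ :=
    hxc.abs.continuousAt.eventually_lt continuousAt_const (by simp [hz, hδ])
  obtain ⟨V, hV, hVo, hzV⟩ := mem_nhds_iff.1 ((hev.and h1).and (e.open_source.mem_nhds hze))
  exact ⟨e, ℓ, w, V, hzV, he, hVo, fun p hp => (hV hp).2, fun p hp => hT.smooth p (hV hp).1.2,
    fun p hp => (hV hp).1.1.1, fun p hp => (hV hp).1.1.2⟩

theorem AdaptedOn.inChart_pull {e : OpenPartialHomeomorph M E} {ℓ : E →L[ℝ] ℝ} {w : E} {V : Set M}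
    (h : AdaptedOn x π e ℓ w V) {j : ℕ} (η : Form E M j) {y : E} (hy : y ∈ e.target)
    (hyV : e.symm y ∈ V) : (η.pull π).inChart e y =
      (η.inChart e (hproj ℓ w y)).compContinuousLinearMap (hproj ℓ w) := by
  have h1 : (e ∘ π ∘ e.symm) =ᶠ[𝓝 y] hproj ℓ w := by
    filter_upwards [(e.isOpen_inter_preimage_symm h.isOpen).mem_nhds ⟨hy, hyV⟩] with q hq
    simp only [Function.comp_apply, h.map_eq _ hq.2, e.right_inv hq.1]
  rw [Form.inChart_pull η h.chart h.chart hy ((h.smooth _ hyV).mdifferentiableAt (by simp))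
    (h.mapsTo _ hyV), h1.fderiv_eq, h1.eq_of_nhds, ContinuousLinearMap.fderiv]

theorem IsStraight.D_eq {e : OpenPartialHomeomorph M E} {ℓ : E →L[ℝ] ℝ} {w : E}
    (h : IsStraight x e ℓ w) {p : M} (hp : p ∈ e.source) : D E ℝ x p = ℓ.comp (D E E e p) := by
  have h1 : x =ᶠ[𝓝 p] ℓ ∘ e := by
    filter_upwards [e.open_source.mem_nhds hp] with q hq using h.eq q hq
  rw [D_congr h1, D_comp ℓ.differentiableAt.mdifferentiableAt (Charts.mdifferentiableAt h.chart hp),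
    D_eq_fderiv, ContinuousLinearMap.fderiv]

/-- Local division of a one-form by `x`, up to multiples of `dx` and forms on the zero set. -/
theorem AdaptedOn.exists_division {e : OpenPartialHomeomorph M E} {ℓ : E →L[ℝ] ℝ} {w : E}
    {V : Set M} (h : AdaptedOn x π e ℓ w V)
    {η : Form E M 1} (hη : ∀ p, η.SmoothAt p) {q : M} (hq : x q = 0) (hqV : q ∈ V) :
    ∃ W : Set M, IsOpen W ∧ q ∈ W ∧ ∃ η' : Form E M 1, (∀ p ∈ W, η'.SmoothAt p) ∧
      ∀ p ∈ W, wedge (D E ℝ x p) (η p) = wedge (D E ℝ x p) (η.pull π p + x p • η' p) := by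
  have hqs := h.subset hqV
  -- At points of the zero set `π` is the projection along `w`, so `ζ` vanishes on `ker ℓ` and `ℓ ∧
  -- ζ = 0` there.
  let ζ : Form E M 1 := fun p => η p - η.pull π p
  let B := e.target ∩ e.symm ⁻¹' V
  have hBo : IsOpen B := e.isOpen_inter_preimage_symm h.isOpen
  have hqB : e q ∈ B := ⟨e.map_source hqs, by simpa [e.left_inv hqs] using hqV⟩
  have hζeq : ∀ y ∈ B, ζ.inChart e y = η.inChart e y -
      (η.inChart e (hproj ℓ w y)).compContinuousLinearMap (hproj ℓ w) := fun y hy => by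
    rw [← h.inChart_pull η hy.1 hy.2]
    rfl
  have hηc : ∀ y ∈ e.target, ContDiffAt ℝ ∞ (η.inChart e) y := fun y hy => by
    have := (hη (e.symm y)).contDiffAt h.chart (e.map_target hy)
    rwa [e.right_inv hy] at this
  have hBproj : ∀ y ∈ B, hproj ℓ w y ∈ e.target := fun y hy => by
    have h1 := h.map_eq _ hy.2
    rw [e.right_inv hy.1] at h1
    rw [← h1]
    exact e.map_source (h.mapsTo _ hy.2)
  have hζs : ∀ y ∈ B, ContDiffAt ℝ ∞ (ζ.inChart e) y := fun y hy => by
    refine ContDiffAt.congr_of_eventuallyEq (f := fun y => η.inChart e y -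
      (η.inChart e (hproj ℓ w y)).compContinuousLinearMap (hproj ℓ w)) ?_
      (Filter.eventually_of_mem (hBo.mem_nhds hy) hζeq)
    refine (hηc y hy.1).sub (contDiffAt_comp_alternating ?_ contDiffAt_const)
    exact (hηc _ (hBproj y hy)).comp y (hproj ℓ w).contDiff.contDiffAt
  have hζ0 : ∀ y ∈ B, ℓ y = 0 → wedge ℓ (ζ.inChart e y) = 0 := fun y hy hy0 => by
    refine wedge_eq_zero_of_ker h.apply_w fun v hv => ?_
    have hP : ∀ u, ℓ u = 0 → hproj ℓ w u = u := fun u hu => by simp [hproj_apply, hu]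
    rw [hζeq y hy, hP y hy0, ContinuousAlternatingMap.sub_apply, comp_one_apply, hP v hv, sub_self]
  obtain ⟨r, hr, hrB⟩ := Metric.nhds_basis_closedBall.mem_iff.1 (hBo.mem_nhds hqB)
  -- The cutoff extends the chart expression of `ζ` to a smooth function on all of `E`, as
  -- Hadamard's lemma requires.
  let χ : ContDiffBump (e q) := ⟨r / 2, r, by linarith, by linarith⟩
  let θ : E → E [⋀^Fin 1]→L[ℝ] ℝ := fun y => χ y • ζ.inChart e y
  have hθ : ContDiff ℝ ∞ θ := contDiff_iff_contDiffAt.2 fun y => by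
    by_cases hy : y ∈ Metric.closedBall (e q) r
    · exact χ.contDiffAt.smul (hζs y (hrB hy))
    · refine (contDiffAt_const (c := 0)).congr_of_eventuallyEq ?_
      filter_upwards [Metric.isClosed_closedBall.isOpen_compl.mem_nhds hy] with s hs
      have : χ s = 0 := χ.zero_of_le_dist (by
        simpa using (not_le.1 fun h' => hs (Metric.mem_closedBall.2 h')).le)
      simp [θ, this]
  have hθ1 : ∀ y ∈ Metric.ball (e q) (r / 2), θ y = ζ.inChart e y := fun y hy => by
    have : χ y = 1 := χ.one_of_mem_closedBall (Metric.ball_subset_closedBall hy)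
    simp [θ, this]
  have hball : Metric.ball (e q) (r / 2) ⊆ B :=
    (Metric.ball_subset_closedBall.trans (Metric.closedBall_subset_closedBall (by linarith))).trans
      hrB
  obtain ⟨θ', hθ', hdiv⟩ := exists_smooth_quotient hθ ℓ w
  have hq0 : ℓ (e q) = 0 := by rw [← h.eq q hqs, hq]
  have hO : ∀ᶠ p in 𝓝 q, p ∈ V ∧ e p ∈ Metric.ball (e q) (r / 2) ∧
      hproj ℓ w (e p) ∈ Metric.ball (e q) (r / 2) := by
    have hc := e.continuousAt hqs
    refine Filter.Eventually.and (h.isOpen.mem_nhds hqV) (Filter.Eventually.and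
      (hc.preimage_mem_nhds (Metric.ball_mem_nhds _ (by linarith))) ?_)
    refine ((hproj ℓ w).continuous.continuousAt.comp hc).preimage_mem_nhds ?_
    have : (⇑(hproj ℓ w) ∘ ⇑e) q = e q := by simp [hproj_apply, hq0]
    rw [this]
    exact Metric.ball_mem_nhds _ (by linarith)
  obtain ⟨W, hW, hWo, hqW⟩ := mem_nhds_iff.1 hO
  refine ⟨W, hWo, hqW, Form.ofChart e θ', fun p hp => ?_, fun p hp => ?_⟩
  · have hps := h.subset (hW hp).1
    refine ⟨e, h.chart, hps, ContDiffAt.congr_of_eventuallyEq hθ'.contDiffAt ?_⟩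
    filter_upwards [e.open_target.mem_nhds (e.map_source hps)] with y hy
    exact Form.inChart_ofChart h.chart θ' hy
  · obtain ⟨hpV, hp1, hp2⟩ := hW hp
    have hps := h.subset hpV
    have h1 := hdiv (e p)
    rw [hθ1 _ hp1, ← hproj_apply, hθ1 _ hp2] at h1
    -- The error of the division is `ζ` at the projected point. It need not vanish, but its wedge
    -- with `dx` does, and this is why the identity holds only under `dx ∧`.
    have h2 : η p - (η.pull π p + x p • Form.ofChart e θ' p) =
        (ζ.inChart e (hproj ℓ w (e p))).compContinuousLinearMap (D E E e p) := by
      have h3 : η p - η.pull π p = (ζ.inChart e (e p)).compContinuousLinearMap (D E E e p) :=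
        Form.apply_eq_inChart h.chart ζ hps
      rw [← sub_sub, h3, h1, add_comp, smul_comp, h.eq p hps, Form.ofChart, add_sub_cancel_right]
    rw [← sub_eq_zero, ← wedge_sub, h2, h.D_eq hps, ← wedge_comp, hζ0 _ (hball hp2)]
    · rfl
    · simp [hproj_apply, h.apply_w]

variable [T2Space M] [CompactSpace M]

theorem Tube.exists_division (hT : Tube E x δ π) (hx : IsDefiningFunction E x) {δ' : ℝ}
    (hδ' : 0 < δ') (hδ : δ' < δ) {η : Form E M 1} (hη : ∀ p, η.SmoothAt p) :
    ∃ η' : Form E M 1, (∀ p, η'.SmoothAt p) ∧ ∀ p, |x p| ≤ δ' →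
      wedge (D E ℝ x p) (η p) = wedge (D E ℝ x p) (η.pull π p + x p • η' p) := by
  have hxc := hx.smooth.continuous
  -- The condition is affine in `η'`, so local solutions can be averaged. Gluing works with pairs of
  -- forms; the second one is a dummy.
  obtain ⟨η', _, hη', _, h⟩ := exists_glue (K := {p | |x p| ≤ δ'}) (i := 1) (j := 1)
    (isClosed_le hxc.abs continuous_const)
    (fun p => {ab | wedge (D E ℝ x p) (η p) = wedge (D E ℝ x p) (η.pull π p + x p • ab.1)})
    (by
      rintro p ⟨a, b⟩ h ⟨a', b'⟩ h' s t _ _ hst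
      simp only [Set.mem_ofPred_eq, wedge_add, wedge_smul, Prod.fst_add, Prod.smul_fst] at *
      have h1 : wedge (D E ℝ x p) (η p) = s • wedge (D E ℝ x p) (η p) +
          t • wedge (D E ℝ x p) (η p) := by rw [← add_smul, hst, one_smul]
      have h2 : ∀ T A B : E [⋀^Fin 2]→L[ℝ] ℝ, s • (T + x p • A) + t • (T + x p • B) =
          (s + t) • T + x p • (s • A + t • B) := fun T A B => by module
      rw [h1]
      nth_rw 1 [h]
      nth_rw 1 [h']
      rw [h2, hst, one_smul])
    (by
      intro q hq
      have hqδ : |x q| < δ := lt_of_le_of_lt hq hδ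
      by_cases hq0 : x q = 0
      · obtain ⟨e, ℓ, w, V, hqV, hV⟩ := hT.exists_adaptedOn (hδ'.trans hδ) hxc hq0
        obtain ⟨W, hW, hqW, η', hs, heq⟩ := hV.exists_division hη hq0 hqV
        exact ⟨W, hW, hqW, η', 0, hs, fun _ _ => Form.SmoothAt.zero, heq⟩
      -- Off the zero set the quotient of `η - π^*η` by `x` is already smooth.
      · refine ⟨{p | x p ≠ 0 ∧ |x p| < δ}, ?_, ⟨hq0, hqδ⟩,
          fun p => (x p)⁻¹ • (η p + (-1 : ℝ) • η.pull π p), 0, fun p hp => ?_,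
          fun _ _ => Form.SmoothAt.zero, fun p hp => ?_⟩
        · exact (isOpen_ne_fun hxc continuous_const).inter (isOpen_lt hxc.abs continuous_const)
        · refine Form.SmoothAt.smul (hx.smooth.contMDiffAt.inv₀ hp.1) ((hη p).add ?_)
          exact ((hη (π p)).pull (hT.smooth p hp.2)).smul contMDiffAt_const
        · simp only [Set.mem_ofPred_eq, smul_smul, mul_inv_cancel₀ hp.1]
          congr 1
          module)
  exact ⟨η', hη', h⟩

theorem Tube.exists_expansion (hT : Tube E x δ π) (hx : IsDefiningFunction E x) {δ' : ℝ}
    (hδ' : 0 < δ') (hδ : δ' < δ) {η : Form E M 1} (hη : ∀ p, η.SmoothAt p) (m : ℕ) :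
    ∃ (a : ℕ → Form E M 1) (η' : Form E M 1), (∀ i p, (a i).SmoothAt p) ∧ (∀ p, η'.SmoothAt p) ∧
      ∀ p, |x p| ≤ δ' → wedge (D E ℝ x p) (η p) = wedge (D E ℝ x p)
        ((∑ i : Fin m, x p ^ (i : ℕ) • (a i).pull π p) + x p ^ m • η' p) := by
  -- Division is made total, with a default for nonsmooth forms, so that it can be chosen as a
  -- function and iterated.
  have hstep : ∀ η : Form E M 1, ∃ η' : Form E M 1, (∀ p, η.SmoothAt p) →
      (∀ p, η'.SmoothAt p) ∧ ∀ p, |x p| ≤ δ' →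
      wedge (D E ℝ x p) (η p) = wedge (D E ℝ x p) (η.pull π p + x p • η' p) := fun η => by
    by_cases hη : ∀ p, η.SmoothAt p
    · obtain ⟨η', h⟩ := hT.exists_division hx hδ' hδ hη
      exact ⟨η', fun _ => h⟩
    · exact ⟨0, fun h => absurd h hη⟩
  choose step hs using hstep
  have hsm : ∀ i p, (step^[i] η).SmoothAt p := fun i => by
    induction i with
    | zero => exact hη
    | succ i ih =>
      rw [Function.iterate_succ_apply']
      exact (hs _ ih).1
  refine ⟨fun i => step^[i] η, step^[m] η, hsm, hsm m, fun p hp => ?_⟩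
  induction m with
  | zero => simp
  | succ m ih =>
    rw [ih, wedge_add, wedge_smul, (hs _ (hsm m)).2 p hp, Fin.sum_univ_castSucc,
      Function.iterate_succ_apply']
    simp only [wedge_add, wedge_smul, Fin.val_castSucc, Fin.val_last, pow_succ, smul_add,
      smul_smul, add_assoc]

/-- On the `b^m`-tangent space `dx = x^m s`, so the remainder contributes `s ∧ x^m a' = dx ∧ a'`,
which has no pole. Off the zero set the claim is the hypothesis divided by `x^m`. On it, all vectors
involved are tangent to `Z`, and evaluating the hypothesis with one transverse vector shows that `a`
and `s` agree on them. -/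
theorem bAt_congr (hx : IsDefiningFunction E x) {m : ℕ} (hm : m ≠ 0) {p : M}
    {a s a' : E [⋀^Fin 1]→L[ℝ] ℝ} (b : E [⋀^Fin 2]→L[ℝ] ℝ)
    (h : wedge (D E ℝ x p) a = wedge (D E ℝ x p) (s + x p ^ m • a')) :
    bAt x m p a b = bAt x m p s (b + wedge (D E ℝ x p) a') := by
  have h' : ∀ v v', D E ℝ x p v * a ![v'] - D E ℝ x p v' * a ![v] =
      D E ℝ x p v * (s ![v'] + x p ^ m * a' ![v']) -
        D E ℝ x p v' * (s ![v] + x p ^ m * a' ![v]) := fun v v' => by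
    have := congrArg (fun c => c ![v, v']) h
    simpa only [wedge_one_apply, ContinuousAlternatingMap.add_apply,
      ContinuousAlternatingMap.smul_apply, smul_eq_mul] using this
  refine ext_two fun u u' => ?_
  have hu : D E ℝ x p (u : E × ℝ).1 = x p ^ m * (u : E × ℝ).2 := u.2
  have hu' : D E ℝ x p (u' : E × ℝ).1 = x p ^ m * (u' : E × ℝ).2 := u'.2
  rw [bAt_apply, bAt_apply, ContinuousAlternatingMap.add_apply, wedge_one_apply, hu, hu']
  by_cases hp : x p = 0
  · obtain ⟨w, hw⟩ : ∃ w, D E ℝ x p w ≠ 0 := by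
      by_contra! h0
      exact hx.regular p hp (ContinuousLinearMap.ext h0)
    rw [hp, zero_pow hm, zero_mul] at hu hu'
    have h1 := h' w (u : E × ℝ).1
    have h2 := h' w (u' : E × ℝ).1
    rw [hu, hp, zero_pow hm] at h1
    rw [hu', hp, zero_pow hm] at h2
    simp only [zero_mul, sub_zero, add_zero] at h1 h2
    rw [mul_left_cancel₀ hw h1, mul_left_cancel₀ hw h2, hp, zero_pow hm]
    ring
  · have h1 := h' (u : E × ℝ).1 (u' : E × ℝ).1
    rw [hu, hu'] at h1
    refine mul_left_cancel₀ (pow_ne_zero m hp) ?_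
    linear_combination h1

end Division

/-! ### Construction of the desingularizing function -/

section Profile

theorem hasDerivAt_neg_inv_pow {n : ℕ} (hn : 1 ≤ n) {t : ℝ} (ht : t ≠ 0) :
    HasDerivAt (fun t : ℝ => -1 / ((n : ℝ) * t ^ n)) (t ^ (n + 1))⁻¹ t := by
  have hn' : (n : ℝ) ≠ 0 := by positivity
  have h := (((hasDerivAt_pow n t).const_mul (n : ℝ)).inv
    (mul_ne_zero hn' (pow_ne_zero n ht))).neg
  have h1 : (fun t : ℝ => -1 / ((n : ℝ) * t ^ n)) = -(fun t : ℝ => ((n : ℝ) * t ^ n))⁻¹ := by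
    funext t
    simp [neg_div]
  rw [h1]
  refine h.congr_deriv ?_
  obtain ⟨m, rfl⟩ := Nat.exists_eq_add_of_le' hn
  simp only [Nat.add_sub_cancel]
  field_simp
  ring

/-- With `h = -1 / (n t^n)`, the function interpolates by an even cutoff `χ` between `t / 2` near
`0` and `h ± 2` for `|t| ≥ 1`. For `t > 0` its derivative is `(1 - χ) / 2 + χ h' + χ' (h + 2 - t /
2)`. The first two terms have positive sum, and the last is nonnegative on `[a, 1]`, where `h + 2 ≥
1 / 2 ≥ t / 2`. Oddness handles negative `t`. -/
theorem exists_isDesingularizing {k : ℕ} (hk : 1 ≤ k) : ∃ f : ℝ → ℝ, IsDesingularizing k f := by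
  obtain ⟨n, hn⟩ : ∃ n, n = 2 * k - 1 := ⟨_, rfl⟩
  have hn1 : 1 ≤ n := by omega
  have hodd : Odd n := ⟨k - 1, by omega⟩
  have hcast : (2 * (k : ℝ) - 1) = n := by
    rw [hn, Nat.cast_sub (by omega)]
    push_cast
    ring
  let h : ℝ → ℝ := fun t => -1 / ((n : ℝ) * t ^ n)
  have hd : ∀ t ≠ 0, HasDerivAt h (t ^ (n + 1))⁻¹ t := fun t ht => hasDerivAt_neg_inv_pow hn1 ht
  have hneg : ∀ t, h (-t) = -h t := fun t => by
    simp only [h, hodd.neg_pow, mul_neg, div_neg]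
  have hsm : ∀ t ≠ 0, ContDiffAt ℝ ∞ h t := fun t ht =>
    contDiffAt_const.div (contDiffAt_const.mul (contDiffAt_id.pow n))
      (mul_ne_zero (by positivity) (pow_ne_zero n ht))
  have h1 : -1 ≤ h 1 := by
    simp only [h, one_pow, mul_one]
    rw [neg_div, neg_le_neg_iff]
    exact (div_le_one (by positivity)).2 (by exact_mod_cast hn1)
  -- Since `h 1 + 2 ≥ 1`, continuity keeps `h + 2` above `1 / 2` slightly to the left of `1`.
  obtain ⟨a, ha0, ha1, ha⟩ : ∃ a, 0 < a ∧ a < 1 ∧ ∀ t, a ≤ t → t ≤ 1 → 1 / 2 ≤ h t + 2 := by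
    have hc : ∀ᶠ t in 𝓝 (1 : ℝ), -3 / 2 < h t :=
      (hd 1 one_ne_zero).continuousAt.eventually_const_lt (by linarith)
    obtain ⟨r, hr, hr'⟩ := Metric.eventually_nhds_iff.1 hc
    refine ⟨1 - min (r / 2) (1 / 2), ?_, ?_, fun t ht ht1 => ?_⟩
    · have := min_le_right (r / 2) (1 / 2)
      linarith
    · have : 0 < min (r / 2) (1 / 2) := lt_min (by linarith) (by norm_num)
      linarith
    · have := min_le_left (r / 2) (1 / 2)
      have := hr' (y := t) (by rw [Real.dist_eq, abs_lt]; constructor <;> linarith)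
      linarith
  have ha2 : 0 < 1 - a ^ 2 := by nlinarith
  let χ : ℝ → ℝ := fun t => Real.smoothTransition ((t ^ 2 - a ^ 2) / (1 - a ^ 2))
  have hχs : ContDiff ℝ ∞ χ := Real.smoothTransition.contDiff.comp (by fun_prop)
  have hχ0 : ∀ t, t ^ 2 ≤ a ^ 2 → χ t = 0 := fun t ht =>
    Real.smoothTransition.zero_of_nonpos (div_nonpos_of_nonpos_of_nonneg (by linarith) ha2.le)
  have hχ1 : ∀ t, 1 ≤ t ^ 2 → χ t = 1 := fun t ht =>
    Real.smoothTransition.one_of_one_le ((one_le_div ha2).2 (by linarith))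
  have hχneg : ∀ t, χ (-t) = χ t := fun t => by simp only [χ, neg_sq]
  -- The sign function makes the formula odd. Its jump and the pole of `h` are harmless because `χ`
  -- vanishes for `|t| ≤ a`.
  let f : ℝ → ℝ := fun t => t / 2 + χ t * (h t + 2 * Real.sign t - t / 2)
  have hfneg : ∀ t, f (-t) = -f t := fun t => by
    simp only [f, hχneg, hneg, Real.sign_neg]
    ring
  have hf0 : ∀ t, t ^ 2 < a ^ 2 → f =ᶠ[𝓝 t] fun t => t / 2 := fun t ht => by
    have : ∀ᶠ s in 𝓝 t, s ^ 2 < a ^ 2 :=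
      (continuous_pow 2).continuousAt.eventually_lt_const ht
    filter_upwards [this] with s hs
    simp [f, hχ0 s hs.le]
  have hfpos : ∀ t, 0 < t → f =ᶠ[𝓝 t] fun t => t / 2 + χ t * (h t + 2 - t / 2) := fun t ht => by
    filter_upwards [lt_mem_nhds ht] with s hs
    simp [f, Real.sign_of_pos hs]
  have hfspos : ∀ t, 0 < t → ContDiffAt ℝ ∞ f t := fun t ht => by
    refine ContDiffAt.congr_of_eventuallyEq ?_ (hfpos t ht)
    exact (contDiffAt_id.div_const 2).add (hχs.contDiffAt.mul
      (((hsm t ht.ne').add contDiffAt_const).sub (contDiffAt_id.div_const 2)))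
  have hfs : ContDiff ℝ ∞ f := contDiff_iff_contDiffAt.2 fun t => by
    rcases lt_trichotomy t 0 with ht | rfl | ht
    · have h2 : f = fun t => -f (-t) := by
        funext s
        rw [hfneg, neg_neg]
      rw [h2]
      exact ((hfspos (-t) (by linarith)).comp t contDiffAt_id.neg).neg
    · exact (contDiffAt_id.div_const 2).congr_of_eventuallyEq (hf0 0 (by
        rw [zero_pow two_ne_zero]; positivity))
    · exact hfspos t ht
  have hχmono : ∀ t, 0 < t → 0 ≤ deriv χ t := fun t ht => by
    have hmono : MonotoneOn χ (Set.Ioi 0) := fun s hs r hr hsr => by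
      refine Real.smoothTransition.monotone ?_
      have : s ^ 2 ≤ r ^ 2 := pow_le_pow_left₀ (le_of_lt hs) hsr 2
      gcongr
    rw [← derivWithin_of_mem_nhds (Ioi_mem_nhds ht)]
    exact hmono.derivWithin_nonneg
  have hderiv : ∀ t, 0 ≤ t → t ≤ 1 → 0 < deriv f t := fun t ht ht1 => by
    rcases lt_or_ge t a with hta | hta
    · rw [(hf0 t (by gcongr)).deriv_eq]
      simp
    · have htpos : 0 < t := ha0.trans_le hta
      have h2 := (hχs.differentiable (by simp) t).hasDerivAt.mul
        (((hd t htpos.ne').add_const 2).sub ((hasDerivAt_id t).div_const 2))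
      have h3 := ((hasDerivAt_id t).div_const 2).add h2
      rw [(hfpos t htpos).deriv_eq]
      have h4 := h3.deriv
      simp only [id] at h4
      refine lt_of_lt_of_eq ?_ h4.symm
      have h5 : 0 ≤ χ t := Real.smoothTransition.nonneg _
      have h6 : χ t ≤ 1 := Real.smoothTransition.le_one _
      have h7 : 0 < (t ^ (n + 1))⁻¹ := by positivity
      have h8 : 0 ≤ deriv χ t * (h t + 2 - t / 2) :=
        mul_nonneg (hχmono t htpos) (by linarith [ha t hta ht1])
      have h9 : 0 < 1 / 2 + χ t * ((t ^ (n + 1))⁻¹ - 1 / 2) := by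
        rcases h5.eq_or_lt with h0 | h0
        · rw [← h0]; norm_num
        · nlinarith [mul_pos h0 h7]
      simp only [Pi.sub_apply] at *
      linarith
  refine ⟨f, hfs, hfneg, fun t ht => ?_, fun t ht => ?_, fun t ht => ?_⟩
  · rcases le_total 0 t with h0 | h0
    · exact hderiv t h0 ht.2
    · have h2 : deriv (fun s => f (-s)) t = deriv (fun s => -f s) t := by
        simp only [hfneg]
      rw [deriv_comp_neg, deriv.fun_neg] at h2
      have := hderiv (-t) (by linarith) (by linarith [ht.1])
      linarith
  · have : χ t = 1 := hχ1 t (by nlinarith)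
    simp only [f, this, Real.sign_of_neg (show t < 0 by linarith), h, hcast, hn]
    ring
  · have : χ t = 1 := hχ1 t (by nlinarith)
    simp only [f, this, Real.sign_of_pos (show 0 < t by linarith), h, hcast, hn]
    ring

end Profile

/-! ### Exterior derivative of Laurent expressions on the model space -/

section ExteriorDerivative

variable {E : Type v} [NormedAddCommGroup E] [NormedSpace ℝ E]

theorem extDeriv_function_smul {j : ℕ} {u : E → ℝ} {S : E → E [⋀^Fin j]→L[ℝ] ℝ} {y : E}
    (hu : DifferentiableAt ℝ u y) (hS : DifferentiableAt ℝ S y) :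
    extDeriv (fun z => u z • S z) y = u y • extDeriv S y + wedge (fderiv ℝ u y) (S y) := by
  rw [extDeriv, fderiv_fun_smul hu hS, ContinuousAlternatingMap.alternatizeUncurryFin_add,
    ContinuousAlternatingMap.alternatizeUncurryFin_smul]
  rfl

theorem contDiffAt_extDeriv {j : ℕ} {S : E → E [⋀^Fin j]→L[ℝ] ℝ} {y : E}
    (hS : ContDiffAt ℝ ∞ S y) : ContDiffAt ℝ ∞ (extDeriv S) y := by
  change ContDiffAt ℝ ∞
    (fun z => ContinuousAlternatingMap.alternatizeUncurryFinCLM ℝ E ℝ (fderiv ℝ S z)) y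
  exact (ContinuousLinearMap.contDiff _).contDiffAt.comp y (hS.fderiv_right (m := ∞) (by simp))

theorem eventually_differentiableAt {F : Type*} [NormedAddCommGroup F] [NormedSpace ℝ F]
    {S : E → F} {y : E} (hS : ContDiffAt ℝ ∞ S y) : ∀ᶠ z in 𝓝 y, DifferentiableAt ℝ S z := by
  have h1 : ContDiffAt ℝ 1 S y := hS.of_le (by simp)
  filter_upwards [h1.eventually (by simp)] with z hz using hz.differentiableAt (by simp)

/-- Write `du ∧ S = d(u S) - u dS` and use `d ∘ d = 0` twice. -/
theorem extDeriv_wedge_fderiv {j : ℕ} {u : E → ℝ} {S : E → E [⋀^Fin j]→L[ℝ] ℝ} {y : E}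
    (hu : ContDiffAt ℝ ∞ u y) (hS : ContDiffAt ℝ ∞ S y) :
    extDeriv (fun z => wedge (fderiv ℝ u z) (S z)) y = -wedge (fderiv ℝ u y) (extDeriv S y) := by
  have h1 : (fun z => wedge (fderiv ℝ u z) (S z)) =ᶠ[𝓝 y]
      fun z => extDeriv (fun z => u z • S z) z + (-1 : ℝ) • (u z • extDeriv S z) := by
    filter_upwards [eventually_differentiableAt hu, eventually_differentiableAt hS] with z hz hz'
    rw [extDeriv_function_smul hz hz']
    module
  have hdS := contDiffAt_extDeriv hS
  have hud := hu.differentiableAt (by simp)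
  have hdd : ∀ {i : ℕ} {T : E → E [⋀^Fin i]→L[ℝ] ℝ}, ContDiffAt ℝ ∞ T y →
      extDeriv (extDeriv T) y = 0 := fun hT =>
    extDeriv_extDeriv_apply hT (by simp; exact WithTop.coe_le_coe.2 le_top)
  have h2 : (fun z => (-1 : ℝ) • (u z • extDeriv S z)) =
    (-1 : ℝ) • fun z => u z • extDeriv S z := rfl
  rw [h1.extDeriv_eq, extDeriv_fun_add, h2, extDeriv_smul,
    extDeriv_function_smul hud (hdS.differentiableAt (by simp)), hdd (T := fun z => u z • S z) (hu.smul hS), hdd hS]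
  · simp
  · exact (contDiffAt_extDeriv (hu.smul hS)).differentiableAt (by simp)
  · exact ((hu.smul hdS).differentiableAt (by simp)).const_smul (-1 : ℝ)

theorem ext_three {a b : E [⋀^Fin 3]→L[ℝ] ℝ} (h : ∀ u v w, a ![u, v, w] = b ![u, v, w]) :
    a = b := by
  ext v
  have : v = ![v 0, v 1, v 2] := by ext i; fin_cases i <;> rfl
  rw [this]
  exact h _ _ _

theorem wedge_two_apply (a : E →L[ℝ] ℝ) (b : E [⋀^Fin 2]→L[ℝ] ℝ) (u v w : E) :
    wedge a b ![u, v, w] = a u * b ![v, w] - a v * b ![u, w] + a w * b ![u, v] := by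
  rw [wedge_apply, Fin.sum_univ_three]
  have h0 : Fin.removeNth (0 : Fin 3) ![u, v, w] = ![v, w] := by
    ext i; fin_cases i <;> rfl
  have h1 : Fin.removeNth (1 : Fin 3) ![u, v, w] = ![u, w] := by
    ext i; fin_cases i <;> rfl
  have h2 : Fin.removeNth (2 : Fin 3) ![u, v, w] = ![u, v] := by
    ext i; fin_cases i <;> rfl
  rw [h0, h1, h2]
  simp
  ring

theorem wedge_wedge_self (a : E →L[ℝ] ℝ) (b : E [⋀^Fin 1]→L[ℝ] ℝ) :
    wedge a (wedge a b) = 0 := by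
  refine ext_three fun u v w => ?_
  rw [wedge_two_apply, wedge_one_apply, wedge_one_apply, wedge_one_apply]
  change _ = (0 : ℝ)
  ring

theorem extDeriv_sum {j : ℕ} {ι : Type*} (s : Finset ι) {S : ι → E → E [⋀^Fin j]→L[ℝ] ℝ} {y : E}
    (hS : ∀ i ∈ s, DifferentiableAt ℝ (S i) y) :
    extDeriv (fun z => ∑ i ∈ s, S i z) y = ∑ i ∈ s, extDeriv (S i) y := by
  rw [extDeriv, fderiv_fun_sum hS]
  exact map_sum (ContinuousAlternatingMap.alternatizeUncurryFinCLM ℝ E ℝ) _ _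

theorem contDiffAt_wedge {X : Type*} [NormedAddCommGroup X] [NormedSpace ℝ X] {j : ℕ}
    {a : X → E →L[ℝ] ℝ} {b : X → E [⋀^Fin j]→L[ℝ] ℝ} {y : X} (ha : ContDiffAt ℝ ∞ a y)
    (hb : ContDiffAt ℝ ∞ b y) : ContDiffAt ℝ ∞ (fun z => wedge (a z) (b z)) y :=
  (wedgeCLM E j).isBoundedBilinearMap.contDiff.contDiffAt.comp y (ha.prodMk hb)

/-- The terms `d(X^i) ∧ A_i` drop out because `du` is proportional to `dX` at `y`. The lemma serves
both the singular form, where `u` is a primitive of `x^{-m}` composed with `x`, and its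
desingularization, where `u = f_ε ∘ x`. -/
theorem extDeriv_laurent {m : ℕ} {u X : E → ℝ} {A : Fin m → E → E [⋀^Fin 1]→L[ℝ] ℝ}
    {B : E → E [⋀^Fin 2]→L[ℝ] ℝ} {y : E} {c : ℝ} (hu : ContDiffAt ℝ ∞ u y)
    (hX : ContDiffAt ℝ ∞ X y) (hA : ∀ i, ContDiffAt ℝ ∞ (A i) y) (hB : ContDiffAt ℝ ∞ B y)
    (huX : fderiv ℝ u y = c • fderiv ℝ X y) :
    extDeriv (fun z => wedge (fderiv ℝ u z) (∑ i : Fin m, X z ^ (i : ℕ) • A i z) + B z) y =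
      -(c • ∑ i : Fin m, X y ^ (i : ℕ) • wedge (fderiv ℝ X y) (extDeriv (A i) y)) +
        extDeriv B y := by
  have hi : ∀ i : Fin m, ContDiffAt ℝ ∞ (fun z => X z ^ (i : ℕ) • A i z) y :=
    fun i => (hX.pow i).smul (hA i)
  have hS : ContDiffAt ℝ ∞ (fun z => ∑ i : Fin m, X z ^ (i : ℕ) • A i z) y :=
    ContDiffAt.sum fun i _ => hi i
  have hW : ContDiffAt ℝ ∞
      (fun z => wedge (fderiv ℝ u z) (∑ i : Fin m, X z ^ (i : ℕ) • A i z)) y :=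
    contDiffAt_wedge (hu.fderiv_right (m := ∞) (by simp)) hS
  rw [extDeriv_fun_add (hW.differentiableAt (by simp)) (hB.differentiableAt (by simp)),
    extDeriv_wedge_fderiv hu hS, extDeriv_sum _ fun i _ => (hi i).differentiableAt (by simp), huX,
    smul_wedge, wedge_sum]
  congr 4
  funext i
  rw [extDeriv_function_smul ((hX.pow i).differentiableAt (by simp))
    ((hA i).differentiableAt (by simp)), wedge_add, wedge_smul,
    fderiv_fun_pow _ (hX.differentiableAt (by simp)), smul_wedge, wedge_smul, wedge_wedge_self,
    smul_zero, add_zero]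

end ExteriorDerivative

/-! ### Closedness of `b^m`-forms off the zero set -/

section Closed

variable {E : Type v} [NormedAddCommGroup E] [NormedSpace ℝ E] [FiniteDimensional ℝ E]
  {M : Type u} [TopologicalSpace M] [ChartedSpace E M] [IsManifold 𝓘(ℝ, E) ∞ M]
  {x : M → ℝ} {m : ℕ}

theorem laurentSum_smoothAt {α : Fin m → Form E M 1} {p : M}
    (hx : ContMDiffAt 𝓘(ℝ, E) 𝓘(ℝ, ℝ) ∞ x p) (hα : ∀ i, (α i).SmoothAt p) :
    (laurentSum x α).SmoothAt p :=
  Form.SmoothAt.sum (η := fun (i : Fin m) q => x q ^ (i : ℕ) • α i q) _ fun i _ =>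
    (hα i).smul (hx.pow i)

theorem extDeriv_inChart_laurent {e : OpenPartialHomeomorph M E} (he : e ∈ Charts E M) {p : M}
    (hp : p ∈ e.source) {g : M → ℝ} {c : ℝ} (hg : ContMDiffAt 𝓘(ℝ, E) 𝓘(ℝ, ℝ) ∞ g p)
    (hx : ContMDiffAt 𝓘(ℝ, E) 𝓘(ℝ, ℝ) ∞ x p) (hgx : D E ℝ g p = c • D E ℝ x p)
    {α : Fin m → Form E M 1} {β : Form E M 2} (hα : ∀ i, (α i).SmoothAt p) (hβ : β.SmoothAt p) :
    extDeriv ((dWedge g (laurentSum x α) + β : Form E M 2).inChart e) (e p) =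
      -(c • ∑ i : Fin m, x p ^ (i : ℕ) •
          wedge (fderiv ℝ (x ∘ e.symm) (e p)) (extDeriv ((α i).inChart e) (e p))) +
        extDeriv (β.inChart e) (e p) := by
  have hy := e.map_source hp
  have h1 : (dWedge g (laurentSum x α) + β : Form E M 2).inChart e =ᶠ[𝓝 (e p)] fun y =>
      wedge (fderiv ℝ (g ∘ e.symm) y)
        (∑ i : Fin m, (x ∘ e.symm) y ^ (i : ℕ) • (α i).inChart e y) + β.inChart e y := by
    filter_upwards [inChart_dWedge_eventuallyEq (laurentSum x α) hg he hp] with y hy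
    have h2 : (dWedge g (laurentSum x α) + β : Form E M 2).inChart e y =
      (dWedge g (laurentSum x α)).inChart e y + β.inChart e y := rfl
    rw [h2, hy]
    congr 2
    simp only [Form.inChart, laurentSum, sum_comp, smul_comp, Function.comp_apply]
  have hD : ∀ {g : M → ℝ}, ContMDiffAt 𝓘(ℝ, E) 𝓘(ℝ, ℝ) ∞ g p →
      fderiv ℝ (g ∘ e.symm) (e p) = (D E ℝ g p).comp (D E E e.symm (e p)) := fun {g} hg => by
    have hg' : MDifferentiableAt 𝓘(ℝ, E) 𝓘(ℝ, ℝ) g (e.symm (e p)) := by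
      rw [e.left_inv hp]; exact hg.mdifferentiableAt (by simp)
    rw [← D_eq_fderiv, D_comp hg' (Charts.mdifferentiableAt_symm he hy), e.left_inv hp]
  rw [h1.extDeriv_eq, extDeriv_laurent (contDiffAt_function hg he hp)
    (contDiffAt_function hx he hp) (fun i => (hα i).contDiffAt he hp) (hβ.contDiffAt he hp) (c := c)
    (by rw [hD hg, hD hx, hgx, ContinuousLinearMap.smul_comp])]
  simp only [Function.comp_apply, e.left_inv hp]

/-- A primitive of `t ^ (-m)`. -/
def polePrimitive (m : ℕ) (t : ℝ) : ℝ := -1 / (((m - 1 : ℕ) : ℝ) * t ^ (m - 1))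

theorem hasDerivAt_polePrimitive (hm : 2 ≤ m) {t : ℝ} (ht : t ≠ 0) :
    HasDerivAt (polePrimitive m) (t ^ m)⁻¹ t := by
  have := hasDerivAt_neg_inv_pow (n := m - 1) (by omega) ht
  rwa [Nat.sub_add_cancel (by omega)] at this

theorem contDiffAt_polePrimitive (hm : 2 ≤ m) {t : ℝ} (ht : t ≠ 0) :
    ContDiffAt ℝ ∞ (polePrimitive m) t := by
  have : ((m - 1 : ℕ) : ℝ) ≠ 0 := by exact_mod_cast (show m - 1 ≠ 0 by omega)
  exact contDiffAt_const.div (contDiffAt_const.mul (contDiffAt_id.pow _))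
    (mul_ne_zero this (pow_ne_zero _ ht))

theorem D_comp_real {g : ℝ → ℝ} {p : M} {c : ℝ} (hg : HasDerivAt g c (x p))
    (hx : MDifferentiableAt 𝓘(ℝ, E) 𝓘(ℝ, ℝ) x p) : D E ℝ (g ∘ x) p = c • D E ℝ x p := by
  rw [D_comp hg.differentiableAt.mdifferentiableAt hx, D_eq_fderiv]
  ext v
  simp [hg.deriv, mul_comm]

theorem toForm_apply {Ω : BForm E x m} {p : M} (hp : x p ≠ 0) {a : E [⋀^Fin 1]→L[ℝ] ℝ}
    {b : E [⋀^Fin 2]→L[ℝ] ℝ} (h : Ω p = bAt x m p a b) :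
    Ω.toForm p = wedge ((x p ^ m)⁻¹ • D E ℝ x p) a + b := by
  rw [BForm.toForm, dif_pos hp, h]
  refine ext_two fun v w => ?_
  rw [comp_two_apply, bAt_apply, ContinuousAlternatingMap.add_apply, wedge_one_apply]
  rfl

/-- For `m ≥ 2` the covector `dx / x^m` is the differential of a power of `x` off the zero set, so
the singular form has the same shape `dg ∧ α + β` as the desingularized one. -/
theorem toForm_eq (hx : IsDefiningFunction E x) (hm : 2 ≤ m) {Ω : BForm E x m} {p : M}
    (hp : x p ≠ 0) {α : Form E M 1} {β : Form E M 2} (h : Ω p = bAt x m p (α p) (β p)) :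
    Ω.toForm p = (dWedge (polePrimitive m ∘ x) α + β : Form E M 2) p := by
  rw [toForm_apply hp h, Pi.add_apply, dWedge, D_comp_real (hasDerivAt_polePrimitive hm hp)
    (hx.smooth.contMDiffAt.mdifferentiableAt (by simp))]

theorem contMDiffAt_polePrimitive (hx : IsDefiningFunction E x) (hm : 2 ≤ m) {p : M}
    (hp : x p ≠ 0) : ContMDiffAt 𝓘(ℝ, E) 𝓘(ℝ, ℝ) ∞ (polePrimitive m ∘ x) p :=
  (contMDiffAt_iff_contDiffAt.2 (contDiffAt_polePrimitive hm hp)).comp p hx.smooth.contMDiffAt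

theorem toForm_smoothAt [T2Space M] [CompactSpace M] (hx : IsDefiningFunction E x) (hm : 2 ≤ m)
    {Ω : BForm E x m} (hΩ : Ω.Smooth) {p : M} (hp : x p ≠ 0) : Ω.toForm.SmoothAt p := by
  obtain ⟨α, β, hα, hβ, h⟩ := hΩ.exists_global
  refine (((hα p).dWedge (contMDiffAt_polePrimitive hx hm hp)).add (hβ p)).congr ?_
  filter_upwards [(isOpen_ne_fun hx.smooth.continuous continuous_const).mem_nhds hp] with q hq
  exact toForm_eq hx hm hq (h q)

theorem IsBSymplectic.toForm_closedAt [T2Space M] [CompactSpace M] (hx : IsDefiningFunction E x)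
    (hm : 2 ≤ m) {Ω : BForm E x m} (hΩ : IsBSymplectic Ω) {p : M} (hp : x p ≠ 0) :
    Ω.toForm.ClosedAt p :=
  (Form.closedOn_iff fun _ hp => toForm_smoothAt hx hm hΩ.smooth hp).1 hΩ.closed p hp

/-- This is `dΩ = 0` off the zero set, solved for `dβ`. -/
theorem IsBSymplectic.extDeriv_eq [T2Space M] [CompactSpace M] (hx : IsDefiningFunction E x)
    (hm : 2 ≤ m) {Ω : BForm E x m} (hΩ : IsBSymplectic Ω) {O : Set M} (hO : IsOpen O)
    {α : Fin m → Form E M 1} {β : Form E M 2}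
    (h : ∀ p ∈ O, Ω p = bAt x m p (laurentSum x α p) (β p))
    (hα : ∀ i, ∀ p ∈ O, (α i).SmoothAt p) (hβ : ∀ p ∈ O, β.SmoothAt p) {p : M} (hp : p ∈ O)
    (hp0 : x p ≠ 0) {e : OpenPartialHomeomorph M E} (he : e ∈ Charts E M) (hpe : p ∈ e.source) :
    extDeriv (β.inChart e) (e p) = (x p ^ m)⁻¹ • ∑ i : Fin m, x p ^ (i : ℕ) •
      wedge (fderiv ℝ (x ∘ e.symm) (e p)) (extDeriv ((α i).inChart e) (e p)) := by
  have h1 : (dWedge (polePrimitive m ∘ x) (laurentSum x α) + β : Form E M 2) =ᶠ[𝓝 p]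
      Ω.toForm := by
    filter_upwards [hO.mem_nhds hp,
      (isOpen_ne_fun hx.smooth.continuous continuous_const).mem_nhds hp0] with q hq hq0
    exact (toForm_eq hx hm hq0 (h q hq)).symm
  have h2 := (hΩ.toForm_closedAt hx hm hp0).congr h1 e he hpe
  rw [extDeriv_inChart_laurent he hpe (contMDiffAt_polePrimitive hx hm hp0)
    hx.smooth.contMDiffAt (D_comp_real (hasDerivAt_polePrimitive hm hp0)
      (hx.smooth.contMDiffAt.mdifferentiableAt (by simp))) (fun i => hα i p hp) (hβ p hp)] at h2
  exact (neg_add_eq_zero.1 h2).symm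

/-- Letting `t → 0` kills the constant coefficient; dividing by `t` lowers `m` by one with the same
`b`. -/
theorem eq_zero_of_polynomial_eq : ∀ {m : ℕ} {κ : Fin m → ℝ} {b : ℝ → ℝ}, ContinuousAt b 0 →
    (∀ᶠ t in 𝓝[≠] (0 : ℝ), ∑ i : Fin m, t ^ (i : ℕ) * κ i = t ^ m * b t) → ∀ i, κ i = 0 := by
  intro m
  induction m with
  | zero => exact fun _ _ i => i.elim0
  | succ m ih =>
    intro κ b hb h
    have h0 : κ 0 = 0 := by
      have h1 : Filter.Tendsto (fun t : ℝ => ∑ i : Fin (m + 1), t ^ (i : ℕ) * κ i) (𝓝[≠] 0)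
          (𝓝 (∑ i : Fin (m + 1), (0 : ℝ) ^ (i : ℕ) * κ i)) :=
        ((continuous_finsetSum _ fun i _ => (continuous_pow _).mul
          continuous_const).tendsto 0).mono_left nhdsWithin_le_nhds
      have h2 : Filter.Tendsto (fun t : ℝ => t ^ (m + 1) * b t) (𝓝[≠] 0)
          (𝓝 ((0 : ℝ) ^ (m + 1) * b 0)) :=
        (((continuous_pow (m + 1)).continuousAt).mul hb).tendsto.mono_left nhdsWithin_le_nhds
      have h3 := tendsto_nhds_unique (h1.congr' h) h2
      simpa [Fin.sum_univ_succ] using h3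
    have hs : ∀ i : Fin m, κ i.succ = 0 := by
      refine ih (κ := fun i => κ i.succ) hb ?_
      filter_upwards [h, self_mem_nhdsWithin] with t ht ht0
      rw [Fin.sum_univ_succ, h0, mul_zero, zero_add] at ht
      refine mul_left_cancel₀ (show t ≠ 0 from ht0) ?_
      rw [Finset.mul_sum, ← mul_assoc, ← pow_succ', ← ht]
      refine Finset.sum_congr rfl fun i _ => ?_
      rw [Fin.val_succ, pow_succ']
      ring
    exact Fin.cases h0 hs

end Closed

/-! ### Existence of the Laurent decomposition -/

section Decomposition

variable {E : Type v} [NormedAddCommGroup E] [NormedSpace ℝ E] [FiniteDimensional ℝ E]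
  {M : Type u} [TopologicalSpace M] [ChartedSpace E M] [IsManifold 𝓘(ℝ, E) ∞ M]
  {x : M → ℝ} {m : ℕ} {δ : ℝ} {π : M → M}

theorem AdaptedOn.extDeriv_inChart_pull {e : OpenPartialHomeomorph M E} {ℓ : E →L[ℝ] ℝ} {w : E}
    {V : Set M} (h : AdaptedOn x π e ℓ w V) {j : ℕ} {η : Form E M j} {p : M} (hp : p ∈ V)
    (hη : η.SmoothAt (π p)) : extDeriv ((η.pull π).inChart e) (e p) =
      (extDeriv (η.inChart e) (hproj ℓ w (e p))).compContinuousLinearMap (hproj ℓ w) := by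
  have hpe := h.subset hp
  have h1 : (e ∘ π ∘ e.symm) =ᶠ[𝓝 (e p)] hproj ℓ w := by
    filter_upwards [(e.isOpen_inter_preimage_symm h.isOpen).mem_nhds
      ⟨e.map_source hpe, by simpa [e.left_inv hpe] using hp⟩] with q hq
    simp only [Function.comp_apply, h.map_eq _ hq.2, e.right_inv hq.1]
  rw [BSymplectic.extDeriv_inChart_pull h.chart h.chart hpe (h.smooth p hp) (h.mapsTo p hp)
    (hη.contDiffAt h.chart (h.mapsTo p hp)), h1.fderiv_eq, h.map_eq p hp,
    ContinuousLinearMap.fderiv]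

theorem Tube.pull_pull (hT : Tube E x δ π) (hxc : Continuous x) {j : ℕ} (η : Form E M j) {p : M}
    (hp : |x p| < δ) : (η.pull π).pull π p = η.pull π p := by
  have hδ : |x (π p)| < δ := by
    rw [hT.zero p hp, abs_zero]; exact (abs_nonneg _).trans_lt hp
  have h1 : (π ∘ π) =ᶠ[𝓝 p] π := by
    filter_upwards [(isOpen_lt hxc.abs continuous_const).mem_nhds hp] with q hq
    exact hT.fixed _ (hT.zero q hq)
  have h2 := D_comp ((hT.smooth _ hδ).mdifferentiableAt (by simp))
    ((hT.smooth p hp).mdifferentiableAt (by simp))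
  rw [D_congr h1] at h2
  simp only [Form.pull, comp_comp, ← h2, hT.fixed _ (hT.zero p hp)]

/-- The coefficients of a Laurent expansion are closed along the zero set. -/
theorem closedAt_of_laurent [T2Space M] [CompactSpace M] (hx : IsDefiningFunction E x)
    (hm : 2 ≤ m) {Ω : BForm E x m} (hΩ : IsBSymplectic Ω) {O : Set M} (hO : IsOpen O)
    {a : Fin m → Form E M 1} {β : Form E M 2}
    (h : ∀ p ∈ O, Ω p = bAt x m p (laurentSum x (fun i => (a i).pull π) p) (β p))
    (ha : ∀ i p, (a i).SmoothAt p) (hβ : ∀ p, β.SmoothAt p) {e : OpenPartialHomeomorph M E}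
    {ℓ : E →L[ℝ] ℝ} {w : E} {V : Set M} (hV : AdaptedOn x π e ℓ w V) {z : M} (hz : x z = 0)
    (hzV : z ∈ V) (hzO : z ∈ O) (i : Fin m) : ((a i).pull π).ClosedAt z := by
  have hze := hV.subset hzV
  have hz0 : ℓ (e z) = 0 := by rw [← hV.eq z hze, hz]
  -- This is the value of `d(π^* a_i)` at every point of the line `e z + t • w` close to `e z`,
  -- because `π` collapses the line to `e z`.
  let c : Fin m → E [⋀^Fin 2]→L[ℝ] ℝ := fun i =>
    (extDeriv ((a i).inChart e) (e z)).compContinuousLinearMap (hproj ℓ w)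
  have hw0 : hproj ℓ w w = 0 := by simp [hproj_apply, hV.apply_w]
  have hPz : hproj ℓ w (e z) = e z := by simp [hproj_apply, hz0]
  have hc : ∀ i v v', c i ![v, v'] = 0 := fun i v v' => by
    let b : ℝ → ℝ := fun t => extDeriv (β.inChart e) (e z + t • w) ![w, v, v']
    refine eq_zero_of_polynomial_eq (m := m) (κ := fun i => c i ![v, v']) (b := b) ?_ ?_ i
    · have h1 : ContinuousAt (fun t : ℝ => e z + t • w) 0 := by fun_prop
      have h2 : ContinuousAt (extDeriv (β.inChart e)) (e z + (0 : ℝ) • w) := by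
        rw [zero_smul, add_zero]
        exact (contDiffAt_extDeriv ((hβ z).contDiffAt hV.chart hze)).continuousAt
      have h3 := ContinuousAt.comp (f := fun t : ℝ => e z + t • w) h2 h1
      exact (ContinuousAlternatingMap.apply ℝ E ℝ ![w, v, v']).continuous.continuousAt.comp h3
    · have hcont : Filter.Tendsto (fun t : ℝ => e z + t • w) (𝓝[≠] 0) (𝓝 (e z)) := by
        have h1 : Continuous (fun t : ℝ => e z + t • w) := by fun_prop
        have := h1.tendsto 0
        simp only [zero_smul, add_zero] at this
        exact this.mono_left nhdsWithin_le_nhds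
      have hOV := hcont.eventually ((e.isOpen_inter_preimage_symm (hO.inter hV.isOpen)).mem_nhds
        ⟨e.map_source hze, by simpa [e.left_inv hze] using And.intro hzO hzV⟩)
      filter_upwards [hOV, self_mem_nhdsWithin] with t ht ht0
      obtain ⟨hte, htO, htV⟩ := ht
      have hte' := e.map_target hte
      have hxt : x (e.symm (e z + t • w)) = t := by
        rw [hV.eq _ hte', e.right_inv hte]
        simp [hz0, hV.apply_w]
      have hey := e.right_inv hte
      have hPy : hproj ℓ w (e z + t • w) = e z := by rw [map_add, map_smul, hw0, hPz]; simp
      have hX : fderiv ℝ (x ∘ e.symm) (e z + t • w) = ℓ := by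
        have h1 : (x ∘ e.symm) =ᶠ[𝓝 (e z + t • w)] ℓ := by
          filter_upwards [e.open_target.mem_nhds hte] with y hy
          rw [Function.comp_apply, hV.eq _ (e.map_target hy), e.right_inv hy]
        rw [h1.fderiv_eq, ContinuousLinearMap.fderiv]
      have hc' : ∀ i, extDeriv (((a i).pull π).inChart e) (e z + t • w) = c i := fun i => by
        have := hV.extDeriv_inChart_pull htV (ha i _)
        rwa [hey, hPy] at this
      have key := hΩ.extDeriv_eq hx hm (hO.inter hV.isOpen) (fun p hp => h p hp.1)
        (fun i p hp => (ha i (π p)).pull (hV.smooth p hp.2)) (fun p _ => hβ p) ⟨htO, htV⟩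
        (by rw [hxt]; exact ht0) hV.chart hte'
      rw [hey, hxt, hX] at key
      simp only [hc'] at key
      -- Contraction with `w` isolates `c i`, since `ℓ w = 1` while the projection kills `w`.
      have hwc : ∀ i, wedge ℓ (c i) ![w, v, v'] = c i ![v, v'] := fun i => by
        have hw1 : ∀ u, c i ![w, u] = 0 := fun u => by
          rw [show c i ![w, u] = _ from comp_two_apply _ _ _ _, hw0]
          exact ContinuousAlternatingMap.map_coord_zero _ 0 rfl
        rw [wedge_two_apply, hw1, hw1, hV.apply_w]
        ring
      have hb : b t = (t ^ m)⁻¹ * ∑ i : Fin m, t ^ (i : ℕ) * c i ![v, v'] := by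
        simp only [b, key, ContinuousAlternatingMap.smul_apply, ContinuousAlternatingMap.sum_apply,
          smul_eq_mul, hwc]
      rw [hb, mul_inv_cancel_left₀ (pow_ne_zero m ht0)]
  have hs : ((a i).pull π).SmoothAt z := (ha i (π z)).pull (hV.smooth z hzV)
  refine hs.closedAt hV.chart hze ?_
  rw [hV.extDeriv_inChart_pull hzV (ha i _), hPz]
  exact ext_two fun v v' => hc i v v'

theorem IsBSymplectic.nonempty_laurentDecomposition [T2Space M] [CompactSpace M]
    (hx : IsDefiningFunction E x) (hm : 2 ≤ m) {Ω : BForm E x m} (hΩ : IsBSymplectic Ω) :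
    Nonempty (LaurentDecomposition Ω) := by
  have hxc := hx.smooth.continuous
  obtain ⟨δ₀, hδ₀, π, hT⟩ := hx.exists_tube
  have hT₀ := hT δ₀ hδ₀ le_rfl
  -- The expansion is available on a closed tube strictly inside the one where `π` is controlled.
  let δ := δ₀ / 2
  have hδ : 0 < δ := half_pos hδ₀
  have hδlt : δ < δ₀ := half_lt_self hδ₀
  have hTδ := hT δ hδ hδlt.le
  obtain ⟨α, β₀, hα, hβ₀, hΩeq⟩ := hΩ.smooth.exists_global
  obtain ⟨a, α', ha, hα', hexp⟩ := hT₀.exists_expansion hx hδ hδlt hα m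
  let β : Form E M 2 := β₀ + dWedge x α'
  have hβ : ∀ p, β.SmoothAt p := fun p => (hβ₀ p).add ((hα' p).dWedge hx.smooth.contMDiffAt)
  let A : Fin m → Form E M 1 := fun i => (a i).pull π
  have hUo : IsOpen {p | |x p| < δ} := isOpen_lt hxc.abs continuous_const
  have heq : ∀ p ∈ {p | |x p| < δ}, Ω p = bAt x m p (laurentSum x A p) (β p) := fun p hp => by
    rw [hΩeq p]
    exact bAt_congr hx (by omega) _ (hexp p (le_of_lt hp))
  have hAs : ∀ i, ∀ p ∈ {p | |x p| < δ}, (A i).SmoothAt p := fun i p hp =>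
    (ha i (π p)).pull (hTδ.smooth p hp)
  have hAc : ∀ i, ∀ p ∈ {p | |x p| < δ}, (A i).ClosedAt p := fun i p hp => by
    have hz := hTδ.zero p hp
    have hzδ : |x (π p)| < δ := by rw [hz, abs_zero]; exact hδ
    obtain ⟨e, ℓ, w, V, hzV, hV⟩ := hTδ.exists_adaptedOn hδ hxc hz
    have h1 := closedAt_of_laurent hx hm hΩ hUo (a := fun i => a i) heq (fun i => ha i) hβ hV hz
      hzV hzδ i
    -- Closedness at the point `π p` of the zero set spreads to `p` because `π^*(π^* a_i) = π^*
    -- a_i`.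
    refine (Form.ClosedAt.pull (hAs i _ hzδ) h1 (hTδ.smooth p hp)).congr ?_
    filter_upwards [hUo.mem_nhds hp] with q hq
    exact (hTδ.pull_pull hxc (a i) hq).symm
  exact ⟨{
    U := {p | |x p| < δ}
    isOpen_U := hUo
    proj := π
    proj_smooth := fun p hp => (hTδ.smooth p hp).contMDiffWithinAt
    zero_subset := fun p hp => by
      have : x p = 0 := hp
      simpa [this] using hδ
    proj_of_zero := hTδ.fixed
    δ := δ
    δ_pos := hδ
    bijOn := hTδ.bijOn
    immersive := hTδ.immersive
    α := A
    α_smooth := fun i => (Form.smoothOn_iff hUo).2 (hAs i)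
    α_closed := fun i => (Form.closedOn_iff (hAs i)).2 (hAc i)
    α_pullback := fun i p hp => (hTδ.pull_pull hxc (a i) hp).symm
    β := β
    β_smooth := (Form.smoothOn_iff hUo).2 fun p _ => hβ p
    eq_on := heq }⟩

end Decomposition

/-! ### Derivative of the rescaled function -/

section Profile

variable {k : ℕ} {f : ℝ → ℝ}

theorem IsDesingularizing.hasDerivAt (hf : IsDesingularizing k f) (hk : 1 ≤ k) {t : ℝ}
    (ht : 1 < |t|) : HasDerivAt f (t ^ (2 * k))⁻¹ t := by
  have hcast : (2 * (k : ℝ) - 1) = ((2 * k - 1 : ℕ) : ℝ) := by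
    rw [Nat.cast_sub (by omega)]
    push_cast
    ring
  have h := hasDerivAt_neg_inv_pow (n := 2 * k - 1) (by omega) (t := t)
    (abs_pos.1 (one_pos.trans ht))
  rw [Nat.sub_add_cancel (by omega)] at h
  rcases lt_abs.1 ht with h1 | h1
  · refine (h.add_const 2).congr_of_eventuallyEq ?_
    filter_upwards [lt_mem_nhds h1] with s hs
    rw [hf.eq_right s hs, hcast]
  · refine (h.sub_const 2).congr_of_eventuallyEq ?_
    filter_upwards [gt_mem_nhds (show t < -1 by linarith)] with s hs
    rw [hf.eq_left s hs, hcast]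

theorem IsDesingularizing.continuous_deriv (hf : IsDesingularizing k f) : Continuous (deriv f) :=
  hf.smooth.continuous_deriv (by simp)

theorem IsDesingularizing.deriv_eq (hf : IsDesingularizing k f) (hk : 1 ≤ k) {t : ℝ}
    (ht : 1 ≤ |t|) : deriv f t = (t ^ (2 * k))⁻¹ := by
  -- The explicit formula for `f` holds only for `|t| > 1`; continuity of the derivative extends its
  -- consequence to `|t| = 1`.
  have hC : IsClosed {t : ℝ | t ^ (2 * k) * deriv f t = 1} :=
    isClosed_eq ((continuous_pow _).mul hf.continuous_deriv) continuous_const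
  have h1 : ∀ t : ℝ, 1 < |t| → t ∈ {t : ℝ | t ^ (2 * k) * deriv f t = 1} := fun t ht => by
    rw [Set.mem_ofPred_eq, (hf.hasDerivAt hk ht).deriv]
    exact mul_inv_cancel₀ (pow_ne_zero _ (abs_pos.1 (one_pos.trans ht)))
  have h2 : t ∈ {t : ℝ | t ^ (2 * k) * deriv f t = 1} := by
    rcases le_abs.1 ht with h | h
    · refine closure_minimal (s := Set.Ioi 1) (fun s hs => h1 s (lt_abs.2 (Or.inl hs))) hC ?_
      rwa [closure_Ioi]
    · refine closure_minimal (s := Set.Iio (-1))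
        (fun s hs => h1 s (lt_abs.2 (Or.inr (lt_neg.1 hs)))) hC ?_
      rw [closure_Iio]
      exact le_neg.1 h
  exact eq_inv_of_mul_eq_one_right h2

theorem IsDesingularizing.exists_le_deriv (hf : IsDesingularizing k f) :
    ∃ κ > 0, ∀ t, |t| ≤ 1 → κ ≤ deriv f t := by
  obtain ⟨s, hs, hmin⟩ := (isCompact_Icc (a := (-1 : ℝ)) (b := 1)).exists_isMinOn
    ⟨0, by norm_num⟩ hf.continuous_deriv.continuousOn
  exact ⟨deriv f s, hf.deriv_pos s hs, fun t ht => hmin (abs_le.1 ht)⟩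

theorem IsDesingularizing.hasDerivAt_scaled (hf : IsDesingularizing k f) (hk : 1 ≤ k) (ε t : ℝ) :
    HasDerivAt (scaled k f ε) ((ε ^ (2 * k))⁻¹ * deriv f (t / ε)) t := by
  have h1 : HasDerivAt f (deriv f (t / ε)) (t / ε) :=
    (hf.smooth.differentiable (by simp)).differentiableAt.hasDerivAt
  have h2 := (h1.comp t ((hasDerivAt_id t).div_const ε)).const_mul (ε ^ (2 * k - 1))⁻¹
  refine h2.congr_deriv ?_
  rw [show 2 * k = 2 * k - 1 + 1 by omega, pow_succ, mul_inv, Nat.add_sub_cancel]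
  ring

theorem IsDesingularizing.hasDerivAt_scaled_of_le (hf : IsDesingularizing k f) (hk : 1 ≤ k)
    {ε t : ℝ} (hε : 0 < ε) (ht : ε ≤ |t|) : HasDerivAt (scaled k f ε) (t ^ (2 * k))⁻¹ t := by
  have h := hf.hasDerivAt_scaled hk ε t
  rwa [hf.deriv_eq hk (by rwa [abs_div, abs_of_pos hε, one_le_div hε]), div_pow, inv_div,
    ← mul_div_assoc, inv_mul_cancel₀ (pow_ne_zero _ hε.ne'), one_div] at h

theorem IsDesingularizing.contDiff_scaled (hf : IsDesingularizing k f) (ε : ℝ) :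
    ContDiff ℝ ∞ (scaled k f ε) :=
  contDiff_const.mul (hf.smooth.comp (contDiff_id.div_const ε))

end Profile

/-! ### Nondegeneracy is an open condition -/

section Nondegenerate

variable {W : Type*} [NormedAddCommGroup W] [NormedSpace ℝ W] [FiniteDimensional ℝ W]

theorem two_smul_left (b : W [⋀^Fin 2]→L[ℝ] ℝ) (c : ℝ) (v w : W) :
    b ![c • v, w] = c * b ![v, w] := by
  have h := b.map_update_smul ![v, w] 0 c v
  have hu : ∀ u, Function.update ![v, w] 0 u = ![u, w] := fun u => by
    ext i; fin_cases i <;> simp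
  rwa [hu, hu] at h

/-- By homogeneity only unit vectors matter. Each has a partner `w` on which the form is nonzero,
this persists nearby, and the unit sphere is compact. -/
theorem eventually_nondegenerate {X : Type*} [NormedAddCommGroup X] [NormedSpace ℝ X]
    {b : X → W [⋀^Fin 2]→L[ℝ] ℝ} {y : X} (hb : ContDiffAt ℝ ∞ b y)
    (h : ∀ v, (∀ w, b y ![v, w] = 0) → v = 0) :
    ∀ᶠ z in 𝓝 y, ∀ v, (∀ w, b z ![v, w] = 0) → v = 0 := by
  have h1 : ∀ᶠ z in 𝓝 y, ∀ v ∈ Metric.sphere (0 : W) 1, ∃ w, b z ![v, w] ≠ 0 := by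
    refine (isCompact_sphere (0 : W) 1).eventually_forall_of_forall_eventually fun v hv => ?_
    have hv0 : v ≠ 0 := by
      rintro rfl
      simp at hv
    obtain ⟨w, hw⟩ : ∃ w, b y ![v, w] ≠ 0 := by
      by_contra hcon
      push Not at hcon
      exact hv0 (h v hcon)
    have h2 : ContDiffAt ℝ ∞ (fun q : X × W => b q.1 ![q.2, w]) (y, v) := by
      refine contDiffAt_apply_alternating (ContDiffAt.comp (y, v) (f := Prod.fst) hb contDiffAt_fst)
        (contDiffAt_pi.2 fun i => ?_)
      fin_cases i
      · exact contDiffAt_snd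
      · exact contDiffAt_const
    filter_upwards [h2.continuousAt.eventually_ne hw] with q hq using ⟨w, hq⟩
  filter_upwards [h1] with z hz v hv
  by_contra hv0
  obtain ⟨w, hw⟩ := hz (‖v‖⁻¹ • v) (by simp [norm_smul, norm_ne_zero_iff.2 hv0])
  exact hw (by rw [two_smul_left, hv, mul_zero])

end Nondegenerate

/-! ### The desingularized form is symplectic -/

section Desingularization

variable {E : Type v} [NormedAddCommGroup E] [NormedSpace ℝ E] [FiniteDimensional ℝ E]
  {M : Type u} [TopologicalSpace M] [ChartedSpace E M] [IsManifold 𝓘(ℝ, E) ∞ M]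
  {x : M → ℝ} {m : ℕ}

theorem LaurentDecomposition.α_smoothAt {Ω : BForm E x m} (L : LaurentDecomposition Ω) {p : M}
    (hp : p ∈ L.U) (i : Fin m) : (L.α i).SmoothAt p :=
  (Form.smoothOn_iff L.isOpen_U).1 (L.α_smooth i) p hp

theorem LaurentDecomposition.β_smoothAt {Ω : BForm E x m} (L : LaurentDecomposition Ω) {p : M}
    (hp : p ∈ L.U) : L.β.SmoothAt p :=
  (Form.smoothOn_iff L.isOpen_U).1 L.β_smooth p hp

theorem LaurentDecomposition.α_closedAt {Ω : BForm E x m} (L : LaurentDecomposition Ω) {p : M}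
    (hp : p ∈ L.U) (i : Fin m) : (L.α i).ClosedAt p :=
  (Form.closedOn_iff fun _ hq => L.α_smoothAt hq i).1 (L.α_closed i) p hp

theorem LaurentDecomposition.extDeriv_β_of_ne [T2Space M] [CompactSpace M]
    (hx : IsDefiningFunction E x) (hm : 2 ≤ m) {Ω : BForm E x m} (hΩ : IsBSymplectic Ω)
    (L : LaurentDecomposition Ω) {p : M} (hp : p ∈ L.U) (hp0 : x p ≠ 0)
    {e : OpenPartialHomeomorph M E} (he : e ∈ Charts E M) (hpe : p ∈ e.source) :
    extDeriv (L.β.inChart e) (e p) = 0 := by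
  rw [hΩ.extDeriv_eq hx hm L.isOpen_U L.eq_on (fun i _ hq => L.α_smoothAt hq i)
    (fun _ hq => L.β_smoothAt hq) hp hp0 he hpe, Finset.sum_eq_zero, smul_zero]
  intro i _
  rw [L.α_closedAt hp i e he hpe, ← wedgeCLM_apply, map_zero, smul_zero]

/-- Off the zero set this follows from `dΩ = 0` and `dα_i = 0`. At a point of it, `dβ` is a limit of
zeros along a line transverse to `Z`. -/
theorem LaurentDecomposition.β_closedAt [T2Space M] [CompactSpace M]
    (hx : IsDefiningFunction E x) (hm : 2 ≤ m) {Ω : BForm E x m} (hΩ : IsBSymplectic Ω)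
    (L : LaurentDecomposition Ω) {p : M} (hp : p ∈ L.U) : L.β.ClosedAt p := by
  by_cases hp0 : x p = 0
  · obtain ⟨e, ℓ, w, he, hpe⟩ := hx.exists_straight hp0
    have hz0 : ℓ (e p) = 0 := by rw [← he.eq p hpe, hp0]
    have h1 : Filter.Tendsto (fun t : ℝ => e p + t • w) (𝓝[≠] 0) (𝓝 (e p)) := by
      have h1 : Continuous (fun t : ℝ => e p + t • w) := by fun_prop
      have := h1.tendsto 0
      simp only [zero_smul, add_zero] at this
      exact this.mono_left nhdsWithin_le_nhds
    refine (L.β_smoothAt hp).closedAt he.chart hpe ?_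
    have h2 := (contDiffAt_extDeriv ((L.β_smoothAt hp).contDiffAt he.chart hpe)).continuousAt
    refine tendsto_nhds_unique (h2.tendsto.comp h1) (tendsto_const_nhds.congr' ?_)
    filter_upwards [h1.eventually ((e.isOpen_inter_preimage_symm L.isOpen_U).mem_nhds
      ⟨e.map_source hpe, by simpa [e.left_inv hpe] using hp⟩), self_mem_nhdsWithin] with t ht ht0
    have hte := e.map_target ht.1
    have hxt : x (e.symm (e p + t • w)) = t := by
      rw [he.eq _ hte, e.right_inv ht.1]
      simp [hz0, he.apply_w]
    have := L.extDeriv_β_of_ne hx hm hΩ ht.2 (by rw [hxt]; exact ht0) he.chart hte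
    rw [e.right_inv ht.1] at this
    exact this.symm
  · exact fun e he hpe => L.extDeriv_β_of_ne hx hm hΩ hp hp0 he hpe

/-- The nondegeneracy near the zero set of the forms `c • dx ∧ S + β` with `c` large. -/
theorem LaurentDecomposition.exists_nondegenerate {Ω : BForm E x m} (hx : IsDefiningFunction E x)
    (hm : m ≠ 0) (hΩ : IsBSymplectic Ω) (L : LaurentDecomposition Ω) {z : M} (hz : x z = 0) :
    ∃ N ∈ 𝓝 z, ∃ τ₀ > 0, ∀ p ∈ N, ∀ c : ℝ, 0 < c → c⁻¹ < τ₀ → ∀ v : E,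
      (∀ v', (wedge (c • D E ℝ x p) (laurentSum x L.α p) + L.β p) ![v, v'] = 0) → v = 0 := by
  obtain ⟨e, ℓ, w, he, hze⟩ := hx.exists_straight hz
  have hzU : z ∈ L.U := L.zero_subset hz
  obtain ⟨K, _, _, _, ι, hι, hιr⟩ : ∃ (K : Type v) (_ : NormedAddCommGroup K)
      (_ : NormedSpace ℝ K) (_ : FiniteDimensional ℝ K) (ι : K →L[ℝ] E),
      Function.Injective ι ∧ ∀ v, ℓ v = 0 ↔ ∃ u, ι u = v :=
    ⟨(ℓ : E →ₗ[ℝ] ℝ).ker, inferInstance, inferInstance, inferInstance,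
      Submodule.subtypeL _, Subtype.val_injective,
      fun v => ⟨fun h => ⟨⟨v, h⟩, rfl⟩, fun ⟨u, hu⟩ => hu ▸ u.2⟩⟩
  -- Here `K` is `ker ℓ`, a model of `T_z Z`. For `τ = c⁻¹ ≠ 0` this is an isomorphism under which
  -- `c ℓ` becomes the second coordinate, so the large factor `c` disappears; `τ = 0` is allowed.
  let A : ℝ → K × ℝ →L[ℝ] E := fun τ =>
    ι.comp (ContinuousLinearMap.fst ℝ K ℝ) +
      τ • (ContinuousLinearMap.snd ℝ K ℝ).smulRight w
  have hA : ∀ τ u, A τ u = ι u.1 + (τ * u.2) • w := fun τ u => by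
    simp [A, mul_smul]
  have hℓA : ∀ τ u, ℓ (A τ u) = τ * u.2 := fun τ u => by
    have : ℓ (ι u.1) = 0 := (hιr _).2 ⟨_, rfl⟩
    rw [hA, map_add, map_smul, he.apply_w, this]
    simp
  let S := (laurentSum x L.α).inChart e
  let B := L.β.inChart e
  let b : E × ℝ → (K × ℝ) [⋀^Fin 2]→L[ℝ] ℝ := fun q =>
    wedge (ContinuousLinearMap.snd ℝ K ℝ) ((S q.1).compContinuousLinearMap (A q.2)) +
      (B q.1).compContinuousLinearMap (A q.2)
  have hb : ∀ q u u', b q ![u, u'] =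
      u.2 * S q.1 ![A q.2 u'] - u'.2 * S q.1 ![A q.2 u] + B q.1 ![A q.2 u, A q.2 u'] :=
    fun q u u' => by
      simp only [b, ContinuousAlternatingMap.add_apply, wedge_one_apply, comp_one_apply]
      exact congrArg₂ (· + ·) rfl (comp_two_apply (B q.1) (A q.2) u u')
  have hsm : ContDiffAt ℝ ∞ b (e z, 0) := by
    have hS : ContDiffAt ℝ ∞ S (e z) := (laurentSum_smoothAt hx.smooth.contMDiffAt
      (L.α_smoothAt hzU)).contDiffAt he.chart hze
    have hB : ContDiffAt ℝ ∞ B (e z) := (L.β_smoothAt hzU).contDiffAt he.chart hze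
    have hA' : ContDiffAt ℝ ∞ (fun q : E × ℝ => A q.2) (e z, 0) :=
      contDiffAt_const.add (contDiffAt_snd.smul contDiffAt_const)
    have hS' : ContDiffAt ℝ ∞ (fun q : E × ℝ => S q.1) (e z, 0) :=
      ContDiffAt.comp (e z, (0 : ℝ)) (f := Prod.fst) hS contDiffAt_fst
    have hB' : ContDiffAt ℝ ∞ (fun q : E × ℝ => B q.1) (e z, 0) :=
      ContDiffAt.comp (e z, (0 : ℝ)) (f := Prod.fst) hB contDiffAt_fst
    exact (contDiffAt_wedge contDiffAt_const (contDiffAt_comp_alternating hS' hA')).add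
      (contDiffAt_comp_alternating hB' hA')
  have hSp : ∀ {p}, p ∈ e.source → ∀ v, laurentSum x L.α p ![v] = S (e p) ![D E E e p v] :=
    fun {p} hp v => by
      rw [Form.apply_eq_inChart he.chart (laurentSum x L.α) hp, comp_one_apply]
  have hBp : ∀ {p}, p ∈ e.source → ∀ v v',
      L.β p ![v, v'] = B (e p) ![D E E e p v, D E E e p v'] := fun {p} hp v v' => by
    rw [Form.apply_eq_inChart he.chart L.β hp, comp_two_apply]
  have hinv : ∀ {p}, p ∈ e.source → ∀ v, D E E e p (D E E e.symm (e p) v) = v :=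
    fun {p} hp v => by
      have := Charts.D_comp_symm he.chart (e.map_source hp)
      rw [e.left_inv hp] at this
      exact congrArg (fun T : E →L[ℝ] E => T v) this
  have hinv' : ∀ {p}, p ∈ e.source → ∀ v, D E E e p v = 0 → v = 0 := fun {p} hp v hv => by
    have := congrArg (fun T : E →L[ℝ] E => T v) (Charts.D_symm_comp he.chart hp)
    simp only [ContinuousLinearMap.comp_apply, hv, map_zero] at this
    exact this.symm
  -- At `τ = 0` the space `K × ℝ` is the `b^m`-tangent space at `z` and the form is `Ω z`, which is
  -- nondegenerate by hypothesis.
  have hnd : ∀ u, (∀ u', b (e z, 0) ![u, u'] = 0) → u = 0 := fun u hu => by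
    have hA0 : ∀ u, A 0 u = ι u.1 := fun u => by rw [hA]; simp
    let U : bTangent E x m z := ⟨(D E E e.symm (e z) (ι u.1), u.2), by
      change D E ℝ x z _ = x z ^ m * _
      rw [hz, zero_pow hm, zero_mul, he.D_eq hze, ContinuousLinearMap.comp_apply, hinv hze]
      exact (hιr _).2 ⟨_, rfl⟩⟩
    have hU : U = 0 := by
      refine hΩ.nondegenerate z U fun U' => ?_
      have h1 : D E ℝ x z (U' : E × ℝ).1 = x z ^ m * (U' : E × ℝ).2 := U'.2
      rw [hz, zero_pow hm, zero_mul, he.D_eq hze, ContinuousLinearMap.comp_apply] at h1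
      obtain ⟨u', hu'⟩ := (hιr _).1 h1
      have h2 := hu (u', (U' : E × ℝ).2)
      rw [hb] at h2
      simp only [hA0, hu'] at h2
      rw [L.eq_on z hzU, bFormOf_eq, bAt_apply, hSp hze, hSp hze, hBp hze]
      simp only [U, hinv hze]
      exact h2
    have h3 : D E E e.symm (e z) (ι u.1) = 0 ∧ u.2 = 0 := by
      have := congrArg (fun V : bTangent E x m z => (V : E × ℝ)) hU
      exact ⟨congrArg Prod.fst this, congrArg Prod.snd this⟩
    refine Prod.ext (hι ?_) h3.2
    rw [← hinv hze (ι u.1), h3.1, map_zero]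
    exact (map_zero ι).symm
  obtain ⟨N, hN, T, hT, hNT⟩ := Filter.eventually_prod_iff.1
    (nhds_prod_eq (x := e z) (y := (0 : ℝ)) ▸ eventually_nondegenerate hsm hnd)
  obtain ⟨τ₀, hτ₀, hball⟩ := Metric.eventually_nhds_iff.1 hT
  refine ⟨_, (((e.continuousAt hze).eventually hN).and (e.open_source.mem_nhds hze)), τ₀, hτ₀,
    fun p hp c hc hcτ v hv => ?_⟩
  obtain ⟨hpN, hpe⟩ := hp
  have hτ : T c⁻¹ := hball (by rwa [Real.dist_eq, sub_zero, abs_of_pos (inv_pos.2 hc)])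
  have hX := he.D_eq hpe
  let y := D E E e p v
  obtain ⟨u₀, hu₀⟩ := (hιr (hproj ℓ w y)).1 (by simp [hproj_apply, he.apply_w])
  -- The preimage of `y` under the rescaling map at `τ = c⁻¹`.
  let u : K × ℝ := (u₀, c * ℓ y)
  have hAu : A c⁻¹ u = y := by
    rw [hA]
    simp only [u, hu₀, hproj_apply, inv_mul_cancel_left₀ hc.ne', sub_add_cancel]
  have hu : u = 0 := by
    refine hNT hpN hτ u fun u' => ?_
    have h1 := hv (D E E e.symm (e p) (A c⁻¹ u'))
    rw [ContinuousAlternatingMap.add_apply, wedge_one_apply, hSp hpe, hSp hpe, hBp hpe,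
      hinv hpe] at h1
    simp only [smul_apply, hX, ContinuousLinearMap.comp_apply, hinv hpe, hℓA,
      smul_eq_mul, mul_inv_cancel_left₀ hc.ne'] at h1
    rw [hb]
    simp only [hAu]
    exact h1
  refine hinv' hpe v ?_
  change y = 0
  rw [← hAu, hu, map_zero]

/-- Off the zero set every `b^m`-tangent vector is the lift of its first component, so a null vector
of the ordinary form lifts to a null vector of `Ω`. -/
theorem IsBSymplectic.toForm_nondegenerate {Ω : BForm E x m} (hΩ : IsBSymplectic Ω) {p : M}
    (hp : x p ≠ 0) (v : E) (hv : ∀ w, Ω.toForm p ![v, w] = 0) : v = 0 := by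
  have h1 : bLift x m p hp v = 0 := by
    refine hΩ.nondegenerate p _ fun u => ?_
    have hu : bLift x m p hp (u : E × ℝ).1 = u := by
      have h2 : D E ℝ x p (u : E × ℝ).1 = x p ^ m * (u : E × ℝ).2 := u.2
      refine Subtype.ext (Prod.ext rfl ?_)
      change (x p ^ m)⁻¹ * D E ℝ x p (u : E × ℝ).1 = _
      rw [h2, inv_mul_cancel_left₀ (pow_ne_zero m hp)]
    have h3 := hv (u : E × ℝ).1
    rwa [BForm.toForm, dif_pos hp, comp_two_apply, hu] at h3
  exact congrArg (fun V : bTangent E x m p => (V : E × ℝ).1) h1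

variable {k : ℕ} {f : ℝ → ℝ}

theorem LaurentDecomposition.desingularization_of_mem {Ω : BForm E x (2 * k)}
    (hx : IsDefiningFunction E x) (hk : 1 ≤ k) (hf : IsDesingularizing k f)
    (L : LaurentDecomposition Ω) (ε : ℝ) {p : M} (hp : p ∈ L.U) :
    L.desingularization f ε p =
      wedge (((ε ^ (2 * k))⁻¹ * deriv f (x p / ε)) • D E ℝ x p) (laurentSum x L.α p) + L.β p := by
  rw [LaurentDecomposition.desingularization, if_pos hp,
    D_comp_real (hf.hasDerivAt_scaled hk ε (x p)) (hx.smooth.contMDiffAt.mdifferentiableAt (by simp))]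

theorem LaurentDecomposition.desingularization_of_le {Ω : BForm E x (2 * k)}
    (hx : IsDefiningFunction E x) (hk : 1 ≤ k) (hf : IsDesingularizing k f)
    (L : LaurentDecomposition Ω) {ε : ℝ} (hε : 0 < ε) {p : M} (hp : ε ≤ |x p|) :
    L.desingularization f ε p = Ω.toForm p := by
  by_cases hpU : p ∈ L.U
  · rw [LaurentDecomposition.desingularization, if_pos hpU,
      D_comp_real (hf.hasDerivAt_scaled_of_le hk hε hp)
        (hx.smooth.contMDiffAt.mdifferentiableAt (by simp))]
    exact (toForm_apply (abs_pos.1 (hε.trans_le hp)) (L.eq_on p hpU)).symm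
  · rw [LaurentDecomposition.desingularization, if_neg hpU]

theorem LaurentDecomposition.eventually_isSymplectic [T2Space M] [CompactSpace M]
    {Ω : BForm E x (2 * k)} (hΩ : IsBSymplectic Ω) (hx : IsDefiningFunction E x) (hk : 1 ≤ k)
    (hf : IsDesingularizing k f) (L : LaurentDecomposition Ω) :
    ∃ ε₀ : ℝ, 0 < ε₀ ∧ ∀ ε : ℝ, 0 < ε → ε < ε₀ → IsSymplectic (L.desingularization f ε) := by
  have hxc := hx.smooth.continuous
  have hm : 2 ≤ 2 * k := by omega
  obtain ⟨κ, hκ, hκf⟩ := hf.exists_le_deriv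
  obtain ⟨ε₁, hε₁, hU⟩ := exists_lt_of_mem_nhds hxc
    fun z hz => L.isOpen_U.mem_nhds (L.zero_subset hz)
  -- Compactness of `M` makes the bound on `ε` uniform. Around a point off the zero set the
  -- condition `|x p| < ε` eventually fails, so only points of `Z` need an argument.
  have hnd : ∀ᶠ ε in 𝓝 (0 : ℝ), ∀ p ∈ (Set.univ : Set M), 0 < ε → |x p| < ε → p ∈ L.U →
      ∀ v : E, (∀ w, L.desingularization f ε p ![v, w] = 0) → v = 0 := by
    refine isCompact_univ.eventually_forall_of_forall_eventually fun z _ => ?_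
    by_cases hz : x z = 0
    · obtain ⟨N, hN, τ₀, hτ₀, hNτ⟩ := L.exists_nondegenerate hx (by omega) hΩ hz
      -- The factor of `dx` is `c = ε^{-2k} f'(x / ε) ≥ κ ε^{-2k}`, whence `c⁻¹ ≤ ε^{2k} κ⁻¹`.
      have h1 : ∀ᶠ ε in 𝓝 (0 : ℝ), ε ^ (2 * k) * κ⁻¹ < τ₀ := by
        have h2 : Continuous fun ε : ℝ => ε ^ (2 * k) * κ⁻¹ := by fun_prop
        refine h2.continuousAt.eventually_lt continuousAt_const ?_
        rwa [zero_pow (by omega), zero_mul]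
      rw [nhds_prod_eq]
      filter_upwards [h1.prod_mk hN] with q hq hε hxq hqU v hv
      have hd : κ ≤ deriv f (x q.2 / q.1) :=
        hκf _ (by rw [abs_div, abs_of_pos hε]; exact (div_le_one hε).2 hxq.le)
      have hd0 := hκ.trans_le hd
      refine hNτ q.2 hq.2 _ (mul_pos (inv_pos.2 (pow_pos hε (2 * k))) hd0) ?_ v fun v' => ?_
      · rw [mul_inv, inv_inv]
        exact (mul_le_mul_of_nonneg_left (inv_anti₀ hκ hd) (pow_pos hε _).le).trans_lt hq.1
      · rw [← L.desingularization_of_mem hx hk hf q.1 hqU]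
        exact hv v'
    · have h1 : ∀ᶠ q : ℝ × M in 𝓝 (0, z), q.1 < |x q.2| := by
        have h2 : IsOpen {q : ℝ × M | q.1 < |x q.2|} :=
          isOpen_lt continuous_fst (hxc.comp continuous_snd).abs
        exact h2.mem_nhds (abs_pos.2 hz)
      filter_upwards [h1] with q hq _ hq'
      exact absurd hq' hq.not_gt
  obtain ⟨ε₂, hε₂, hball⟩ := Metric.eventually_nhds_iff.1 hnd
  refine ⟨min ε₁ ε₂, lt_min hε₁ hε₂, fun ε hε hlt => ?_⟩
  have hε1 := hlt.trans_le (min_le_left _ _)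
  have hε2 := hlt.trans_le (min_le_right _ _)
  have hnear : ∀ {p}, p ∈ L.U → L.desingularization f ε =ᶠ[𝓝 p]
      (dWedge (scaled k f ε ∘ x) (laurentSum x L.α) + L.β : Form E M 2) := fun {p} hp => by
    filter_upwards [L.isOpen_U.mem_nhds hp] with q hq
    rw [LaurentDecomposition.desingularization, if_pos hq]
    rfl
  have hfar : ∀ {p}, ε < |x p| → L.desingularization f ε =ᶠ[𝓝 p] Ω.toForm := fun {p} hp => by
    filter_upwards [(isOpen_lt continuous_const hxc.abs).mem_nhds hp] with q hq
    exact L.desingularization_of_le hx hk hf hε (le_of_lt hq)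
  have hsc : ∀ p, ContMDiffAt 𝓘(ℝ, E) 𝓘(ℝ, ℝ) ∞ (scaled k f ε ∘ x) p := fun p =>
    (contMDiffAt_iff_contDiffAt.2 (hf.contDiff_scaled ε).contDiffAt).comp p hx.smooth.contMDiffAt
  -- The open sets `U` and `{|x| > ε}` cover `M` because `ε < ε₁`. On the first the form has its
  -- Laurent shape, on the second it is `Ω`, so no separate argument is needed at the boundary of
  -- `U`.
  have hcase : ∀ p, p ∈ L.U ∨ ε < |x p| := fun p => by
    rcases lt_or_ge |x p| ε₁ with h | h
    · exact Or.inl (hU p h)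
    · exact Or.inr (hε1.trans_le h)
  have hsmooth : ∀ p, (L.desingularization f ε).SmoothAt p := fun p => by
    rcases hcase p with hp | hp
    · exact (((laurentSum_smoothAt hx.smooth.contMDiffAt (L.α_smoothAt hp)).dWedge (hsc p)).add
        (L.β_smoothAt hp)).congr (hnear hp)
    · exact (toForm_smoothAt hx hm hΩ.smooth (abs_pos.1 (hε.trans hp))).congr (hfar hp)
  refine ⟨(Form.smoothOn_iff isOpen_univ).2 fun p _ => hsmooth p,
    (Form.closedOn_iff fun p _ => hsmooth p).2 fun p _ => ?_, fun p v hv => ?_⟩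
  · rcases hcase p with hp | hp
    · refine Form.ClosedAt.congr (fun e he hpe => ?_) (hnear hp)
      rw [extDeriv_inChart_laurent he hpe (hsc p) hx.smooth.contMDiffAt
        (D_comp_real (hf.hasDerivAt_scaled hk ε (x p))
          (hx.smooth.contMDiffAt.mdifferentiableAt (by simp))) (L.α_smoothAt hp) (L.β_smoothAt hp),
        L.β_closedAt hx hm hΩ hp e he hpe, Finset.sum_eq_zero, smul_zero, neg_zero, add_zero]
      intro i _
      rw [L.α_closedAt hp i e he hpe, ← wedgeCLM_apply, map_zero, smul_zero]
    · exact (hΩ.toForm_closedAt hx hm (abs_pos.1 (hε.trans hp))).congr (hfar hp)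
  · rcases lt_or_ge |x p| ε with hp | hp
    · refine hball ?_ p (Set.mem_univ p) hε hp (hU p (hp.trans hε1)) v hv
      rwa [Real.dist_eq, sub_zero, abs_of_pos hε]
    · refine hΩ.toForm_nondegenerate (abs_pos.1 (hε.trans_le hp)) v fun w => ?_
      rw [← L.desingularization_of_le hx hk hf hε hp]
      exact hv w

end Desingularization

end BSymplectic

end

/-! ### Assembly of the theorem -/

theorem mainTheorem6 {E : Type v} [NormedAddCommGroup E] [NormedSpace ℝ E]
    [FiniteDimensional ℝ E]
    {M : Type u} [TopologicalSpace M] [ChartedSpace E M] [IsManifold 𝓘(ℝ, E) ∞ M]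
    [T2Space M] [CompactSpace M]
    (k : ℕ) (hk : 1 ≤ k) (x : M → ℝ) (hx : IsDefiningFunction E x)
    (Ω : BForm E x (2 * k)) (hΩ : IsBSymplectic Ω) :
    -- `M` carries a symplectic form,
    (∃ σ : Form E M 2, IsSymplectic σ) ∧
    -- namely a desingularization of `Ω`: the data entering its construction exist,
    (∃ f : ℝ → ℝ, IsDesingularizing k f) ∧
    Nonempty (LaurentDecomposition Ω) ∧
    -- and for every choice of them it is symplectic, and equal to `Ω` off the
    -- `ε`-neighbourhood of `Z`, when `ε` is small;
    (∀ f : ℝ → ℝ, IsDesingularizing k f → ∀ L : LaurentDecomposition Ω,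
      ∃ ε₀ : ℝ, 0 < ε₀ ∧ ∀ ε : ℝ, 0 < ε → ε < ε₀ →
        IsSymplectic (L.desingularization f ε) ∧
        ∀ p : M, ε ≤ |x p| → L.desingularization f ε p = Ω.toForm p) ∧
    -- hence `M` has every property that all compact symplectic manifolds have.
    (∀ P : ∀ (N : Type u) (_ : TopologicalSpace N) (_ : ChartedSpace E N), Prop,
      (∀ (N : Type u) [TopologicalSpace N] [ChartedSpace E N] [IsManifold 𝓘(ℝ, E) ∞ N]
        [T2Space N] [CompactSpace N], (∃ σ : Form E N 2, IsSymplectic σ) →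
        P N inferInstance inferInstance) →
      P M inferInstance inferInstance) := by
  obtain ⟨f, hf⟩ := exists_isDesingularizing hk
  obtain ⟨L⟩ := hΩ.nonempty_laurentDecomposition hx (by omega)
  have main : ∀ f : ℝ → ℝ, IsDesingularizing k f → ∀ L : LaurentDecomposition Ω,
      ∃ ε₀ : ℝ, 0 < ε₀ ∧ ∀ ε : ℝ, 0 < ε → ε < ε₀ →
        IsSymplectic (L.desingularization f ε) ∧
        ∀ p : M, ε ≤ |x p| → L.desingularization f ε p = Ω.toForm p := fun f hf L => by
    obtain ⟨ε₀, hε₀, h⟩ := L.eventually_isSymplectic hΩ hx hk hf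
    exact ⟨ε₀, hε₀, fun ε hε hlt =>
      ⟨h ε hε hlt, fun p hp => L.desingularization_of_le hx hk hf hε hp⟩⟩
  obtain ⟨ε₀, hε₀, h⟩ := main f hf L
  have hσ : ∃ σ : Form E M 2, IsSymplectic σ :=
    ⟨_, (h (ε₀ / 2) (half_pos hε₀) (half_lt_self hε₀)).1⟩
  exact ⟨hσ, ⟨f, hf⟩, ⟨L⟩, main, fun P hP => hP M hσ⟩
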